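/- \textbf{Theorem.} Let $\alpha\ge -1/2$ and let $J_\alpha(x)=\sum_{k=0}^\infty \frac{(-1)^k}{k!\,\Gamma(k+\alpha+1)}\left(\frac x2\right)^{\alpha+2k}$, $x>0$, be the Bessel function of order $\alpha$. For $f:(0,\infty)\to\mathbb C$ the Hankel transform of order $\alpha$ is the improper integral $$H_\alpha f(y)=\lim_{M\to0+,\;N\to\infty}\int_M^N f(x)\sqrt{xy}\,J_\alpha(xy)\,dx,\qquad y>0 .$$ A function $f:(0,\infty)\to\mathbb C$ is general monotone with constants $C>0$ and $\lambda>1$ if it is locally of bounded variation and $$\int_x^{2x}|df(t)|\le C\int_{x/\lambda}^{\lambda x}\frac{|f(t)|}{t}\,dt\qquad\text{for all }x>0 ;$$ $f\in GM$ means that this holds for some $C>0$ and $\lambda>1$. For $1\le q\le\infty$ and a parameter $r$ with $1/r\in\mathbb R$ (where $r=\infty$, $1/r=0$ and negative $r$ are allowed), $L^q_{t(r,q)}$ is the set of measurable $f:(0,\infty)\to\mathbb C$ for which $$\|f\|_{L^q_{t(r,q)}}=\Big(\int_0^\infty x^{q/r-1}|f(x)|^q\,dx\Big)^{1/q}\quad(q<\infty),\qquad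 \|f\|_{L^\infty_{t(r,\infty)}}=\sup_{x>0}x^{1/r}|f(x)|\quad(q=\infty)$$ is finite. Let $1\le q\le\infty$, $\frac1{\alpha+3/2}<p<\infty$, and let $p'$ be given by $\frac1{p'}=1-\frac1p$. If $f\in GM$ and $f\in L^q_{t(p,q)}$, then the limit defining $H_\alpha f(y)$ exists for every $y>0$, $H_\alpha f\in L^q_{t(p',q)}$, and $$\|H_\alpha f\|_{L^q_{t(p',q)}}\le K\,\|f\|_{L^q_{t(p,q)}},$$ where the constant $K$ depends only on $\alpha$, $p$, $q$ and the constants $C,\lambda$ for which $f$ is general monotone. -/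

import Mathlib

open Set Filter Topology MeasureTheory
open scoped ENNReal Nat

noncomputable section

/-- The Bessel function of the first kind of order `α`, through its power series
(used for `α ≥ -1/2` and `x > 0`). -/
def besselJ (α x : ℝ) : ℝ :=
  ∑' k : ℕ, (-1 : ℝ) ^ k / ((k ! : ℝ) * Real.Gamma ((k : ℝ) + α + 1)) *
    (x / 2) ^ (α + 2 * (k : ℝ))

/-- The integrand `f(x) √(xy) J_α(xy)` of the Hankel transform of order `α` at `y`. -/
def hankelIntegrand (α : ℝ) (f : ℝ → ℂ) (y x : ℝ) : ℂ :=
  f x * ((Real.sqrt (x * y) * besselJ α (x * y) : ℝ) : ℂ)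

/-- `L` is the value of the improper integral `∫₀^∞ f(x) √(xy) J_α(xy) dx`: the integrand is
integrable on every compact subinterval of `(0,∞)`, and its integral over `[M, N]` tends to `L` as
`M → 0+` and `N → ∞` independently of each other. -/
def HasHankelIntegral (α : ℝ) (f : ℝ → ℂ) (y : ℝ) (L : ℂ) : Prop :=
  (∀ M N : ℝ, 0 < M → M ≤ N →
    IntervalIntegrable (hankelIntegrand α f y) volume M N) ∧
  Tendsto (fun I : ℝ × ℝ => ∫ x in I.1..I.2, hankelIntegrand α f y x)
    (𝓝[>] (0 : ℝ) ×ˢ atTop) (𝓝 L)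

/-- The Hankel transform of order `α`, as a pointwise limit. It is meaningful at those `y > 0`
where the limit exists, that is, where `HasHankelIntegral α f y (hankel α f y)` holds. -/
def hankel (α : ℝ) (f : ℝ → ℂ) (y : ℝ) : ℂ :=
  limUnder (𝓝[>] (0 : ℝ) ×ˢ atTop)
    (fun I : ℝ × ℝ => ∫ x in I.1..I.2, hankelIntegrand α f y x)

/-- `f` is general monotone on `(0,∞)` with constants `C` and `lam`: it is locally of bounded
variation there, and for all `x > 0` its total variation over `[x, 2x]` is at most
`C ∫_{x/lam}^{lam x} |f(t)|/t dt`. Values of `f` outside `(0,∞)` play no role. -/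
def IsGMWith (C lam : ℝ) (f : ℝ → ℂ) : Prop :=
  LocallyBoundedVariationOn f (Ioi 0) ∧
  ∀ x : ℝ, 0 < x →
    eVariationOn f (Icc x (2 * x)) ≤
      ENNReal.ofReal C * ∫⁻ t in Icc (x / lam) (lam * x), ‖f t‖ₑ / ENNReal.ofReal t

/-- The functional `‖f‖_{L^q(w)}` on functions on `(0,∞)`, with values in `[0,∞]`. -/
def weightedNorm (q : ℝ≥0∞) (w : ℝ → ℝ) (f : ℝ → ℂ) : ℝ≥0∞ :=
  if q = ∞ then ⨆ x ∈ Ioi (0 : ℝ), ENNReal.ofReal (w x) * ‖f x‖ₑ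
  else (∫⁻ x in Ioi (0 : ℝ), ENNReal.ofReal (w x) * ‖f x‖ₑ ^ q.toReal) ^ (1 / q.toReal)

/-- The weight of `L^q_{t(p,q)}` in terms of `s = 1/p`: it is `x ^ (q/p - 1)` for `q < ∞` and
`x ^ (1/p)` for `q = ∞`. Taking `s` as the parameter makes sense of `L^q_{t(p',q)}`, with
`1/p' = 1 - 1/p`, also when `p ≤ 1`. -/
def tWeight (s : ℝ) (q : ℝ≥0∞) (x : ℝ) : ℝ :=
  if q = ∞ then x ^ s else x ^ (q.toReal * s - 1)

/-- The norm of `L^q_{t(p,q)}`, where `s = 1/p`. -/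
def tNorm (s : ℝ) (q : ℝ≥0∞) (f : ℝ → ℂ) : ℝ≥0∞ :=
  weightedNorm q (tWeight s q) f

/-- Membership in `L^q_{t(p,q)}`, where `s = 1/p`: Lebesgue measurable on `(0,∞)`, with finite
norm. -/
def MemT (s : ℝ) (q : ℝ≥0∞) (f : ℝ → ℂ) : Prop :=
  AEStronglyMeasurable f (volume.restrict (Ioi 0)) ∧ tNorm s q f < ∞

end

/-!
Write `φ(z) = √z J_α(z)`, `β = α + 3/2` and `s = 1/p`, so that `0 < s < β`. Two properties of the
kernel are used: `|φ(z)| ≤ A z^(α+1/2)` on `(0,1]`, from the power series, and the boundedness of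
`∫_w^z φ` for `1 ≤ w ≤ z`. The latter needs no asymptotic expansion: Bessel's equation
`φ'' = -(1 + (1/4 - α²)/z²) φ` shows that the energy `φ² + φ'²` is bounded on `[1,∞)`
(`exists_besselKernel_bound`), and then integrating the equation bounds `∫ φ`
(`exists_abs_integral_besselKernel_le`).

For a general monotone `f`, a dyadic decomposition bounds both `|f(a)|` and the variation of `f` on
`[a,∞)` by a multiple of `∫_{a/r}^∞ |f(t)|/t dt` (`exists_variation_le_tail`). Splitting the
Hankel integral at `x = 1/y`, estimating the part near `0` absolutely and the part near `∞` by an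
integration by parts (`norm_integral_mul_le_of_boundedVariationOn`), gives convergence together with
`y |H_α f(y)| ≤ A ∫₀^∞ |f(u)| min((uy)^β, 1) du/u` (`exists_hankel_le_hardyOp`).

The right-hand side is an integral operator (`hardyOp`) on the multiplicative group `(0,∞)`. With
the weights `u^s` and `y^(-s)` moved into its kernel, it has the kernel `min(z^β, 1) z^(-s)` at
`z = uy`, whose integral against `dz/z` is finite exactly because `0 < s < β`. The Schur test
(`schur_test`) therefore gives the norm inequality (`tNorm_le_of_le_hardyOp`), and also the
finiteness of the operator at every point (`hardyOp_ne_top`).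
-/

/-! ### Power series with factorially decaying coefficients -/

theorem summable_mul_pow_of_le_factorial {c : ℕ → ℝ} {A R : ℝ}
    (hc : ∀ k, |c k| ≤ A * R ^ k / k !) (t : ℝ) : Summable fun k => c k * t ^ k := by
  refine Summable.of_norm_bounded (g := fun k : ℕ => A * ((R * |t|) ^ k / k !))
    ((Real.summable_pow_div_factorial _).mul_left A) fun k => ?_
  rw [norm_mul, norm_pow, Real.norm_eq_abs, Real.norm_eq_abs]
  calc |c k| * |t| ^ k ≤ A * R ^ k / k ! * |t| ^ k := by gcongr; exact hc k
    _ = A * ((R * |t|) ^ k / k !) := by rw [mul_pow]; ring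

/-- The factorial bound passes to the coefficients of the derivative. -/
theorem succ_mul_le_factorial {c : ℕ → ℝ} {A R : ℝ}
    (hc : ∀ k, |c k| ≤ A * R ^ k / k !) (k : ℕ) :
    |((k : ℝ) + 1) * c (k + 1)| ≤ A * R * R ^ k / k ! := by
  rw [abs_mul, abs_of_nonneg (by positivity : (0 : ℝ) ≤ k + 1)]
  calc ((k : ℝ) + 1) * |c (k + 1)| ≤ (k + 1) * (A * R ^ (k + 1) / (k + 1)!) := by
        gcongr; exact hc _
    _ = A * R * R ^ k / k ! := by
        rw [Nat.factorial_succ]; push_cast; field_simp; ring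

/-- Term-by-term differentiation; by `succ_mul_le_factorial` it can be iterated. -/
theorem hasDerivAt_tsum_mul_pow {c : ℕ → ℝ} {A R : ℝ}
    (hc : ∀ k, |c k| ≤ A * R ^ k / k !) (t : ℝ) :
    HasDerivAt (fun t => ∑' k : ℕ, c k * t ^ k)
      (∑' k : ℕ, ((k : ℝ) + 1) * c (k + 1) * t ^ k) t := by
  set r := |t| + 1 with hr
  have hr0 : 0 < r := by positivity
  have h1 : ∀ x ∈ Ioo (-r) r, |x| ≤ r := fun x hx => (abs_lt.2 hx).le
  have ht : t ∈ Ioo (-r) r := abs_lt.1 (by rw [hr]; linarith)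
  have hd : ∀ x, Summable fun k : ℕ => ((k : ℝ) + 1) * c (k + 1) * x ^ k := fun x =>
    summable_mul_pow_of_le_factorial (succ_mul_le_factorial hc) x
  have hu' : Summable fun k : ℕ => |((k : ℝ) + 1) * c (k + 1)| * r ^ k :=
    summable_mul_pow_of_le_factorial (c := fun k : ℕ => |((k : ℝ) + 1) * c (k + 1)|)
      (fun k => by rw [abs_abs]; exact succ_mul_le_factorial hc k) r
  have hu : Summable fun k : ℕ => |(k : ℝ) * c k| * r ^ (k - 1) := by
    rw [← summable_nat_add_iff 1]
    simpa using hu'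
  have := hasDerivAt_tsum_of_isPreconnected (g := fun k x => c k * x ^ k)
    (g' := fun k x => c k * (k * x ^ (k - 1))) hu isOpen_Ioo isPreconnected_Ioo
    (fun n y _ => (hasDerivAt_pow n y).const_mul (c n)) (fun n y hy => ?_) ht
    (summable_mul_pow_of_le_factorial hc t) ht
  · convert! this using 1
    rw [Summable.tsum_eq_zero_add (f := fun k : ℕ => c k * ((k : ℝ) * t ^ (k - 1)))]
    · simp only [Nat.cast_zero, zero_mul, mul_zero, zero_add, Nat.cast_add, Nat.cast_one,
        Nat.add_sub_cancel]
      exact tsum_congr fun k => by ring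
    · rw [← summable_nat_add_iff 1]
      refine (hd t).congr fun k => ?_
      simp only [Nat.cast_add, Nat.cast_one, Nat.add_sub_cancel]
      ring
  · rw [norm_mul, norm_mul, norm_pow, Real.norm_eq_abs, Real.norm_eq_abs, Real.norm_eq_abs,
      ← mul_assoc, abs_mul, mul_comm |c n|]
    gcongr
    exact h1 y hy

/-! ### The Bessel function -/

/-- The coefficients of `t ↦ ∑ (-1)^k t^k / (k! Γ(k+α+1))`, whose value at `z²/4` is
`(z/2)^(-α) J_α(z)`. -/
noncomputable def besselCoeff (α : ℝ) (k : ℕ) : ℝ :=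
  (-1 : ℝ) ^ k / ((k ! : ℝ) * Real.Gamma ((k : ℝ) + α + 1))

/-- A crude bound from `Γ(z+1) = z Γ(z)`, in which every factor `z` is at least `1/2`. -/
theorem Gamma_lower_bound {α : ℝ} (hα : -1 / 2 ≤ α) (k : ℕ) :
    Real.Gamma (α + 1) * (1 / 2) ^ k ≤ Real.Gamma ((k : ℝ) + α + 1) := by
  induction k with
  | zero => simp
  | succ k ih =>
    have h0 : 0 < Real.Gamma ((k : ℝ) + α + 1) :=
      Real.Gamma_pos_of_pos (by have : (0 : ℝ) ≤ k := k.cast_nonneg; linarith)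
    have hk : (0 : ℝ) ≤ k := k.cast_nonneg
    have h := Real.Gamma_add_one (s := (k : ℝ) + α + 1) (by linarith)
    rw [show ((k + 1 : ℕ) : ℝ) + α + 1 = (k : ℝ) + α + 1 + 1 by push_cast; ring, h, pow_succ]
    nlinarith

theorem abs_besselCoeff_le {α : ℝ} (hα : -1 / 2 ≤ α) (k : ℕ) :
    |besselCoeff α k| ≤ (Real.Gamma (α + 1))⁻¹ * 2 ^ k / k ! := by
  have h0 : 0 < Real.Gamma (α + 1) := Real.Gamma_pos_of_pos (by linarith)
  have h1 := Gamma_lower_bound hα k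
  have h2 : 0 < Real.Gamma (α + 1) * (1 / 2) ^ k := by positivity
  have h3 := h2.trans_le h1
  rw [besselCoeff, abs_div, abs_pow, abs_neg, abs_one, one_pow,
    abs_of_pos (mul_pos (by positivity) h3)]
  calc 1 / ((k ! : ℝ) * Real.Gamma (k + α + 1))
      ≤ 1 / ((k ! : ℝ) * (Real.Gamma (α + 1) * (1 / 2) ^ k)) := by gcongr
    _ = _ := by rw [one_div_pow]; field_simp

theorem besselCoeff_succ {α : ℝ} (hα : -1 / 2 ≤ α) (k : ℕ) :
    ((k : ℝ) + 1) * (k + α + 1) * besselCoeff α (k + 1) = -besselCoeff α k := by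
  have hk : (0 : ℝ) ≤ k := k.cast_nonneg
  have h0 : 0 < Real.Gamma ((k : ℝ) + α + 1) := Real.Gamma_pos_of_pos (by linarith)
  have h := Real.Gamma_add_one (s := (k : ℝ) + α + 1) (by linarith)
  have h4 : (k : ℝ) + α + 1 ≠ 0 := by linarith
  rw [besselCoeff, besselCoeff,
    show ((k + 1 : ℕ) : ℝ) + α + 1 = (k : ℝ) + α + 1 + 1 by push_cast; ring, h,
    Nat.factorial_succ]
  push_cast
  field_simp
  ring

/-- The entire function `G` with `J_α(z) = (z/2)^α G(z²/4)`. -/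
noncomputable def besselG (α t : ℝ) : ℝ := ∑' k : ℕ, besselCoeff α k * t ^ k

/-- The derivative of `besselG α`. -/
noncomputable def besselG' (α t : ℝ) : ℝ := ∑' k : ℕ, ((k : ℝ) + 1) * besselCoeff α (k + 1) * t ^ k

theorem hasDerivAt_besselG {α : ℝ} (hα : -1 / 2 ≤ α) (t : ℝ) :
    HasDerivAt (besselG α) (besselG' α t) t :=
  hasDerivAt_tsum_mul_pow (abs_besselCoeff_le hα) t

/-- The differential equation `t G'' + (α + 1) G' + G = 0`. -/
theorem exists_hasDerivAt_besselG' {α : ℝ} (hα : -1 / 2 ≤ α) (t : ℝ) :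
    ∃ g, HasDerivAt (besselG' α) g t ∧ t * g = -(α + 1) * besselG' α t - besselG α t := by
  have hc := succ_mul_le_factorial (abs_besselCoeff_le hα)
  refine ⟨_, hasDerivAt_tsum_mul_pow hc t, ?_⟩
  have s0 := summable_mul_pow_of_le_factorial (abs_besselCoeff_le hα) t
  have s1 := summable_mul_pow_of_le_factorial hc t
  have s2 := summable_mul_pow_of_le_factorial (succ_mul_le_factorial hc) t
  have e : t * ∑' k : ℕ, ((k : ℝ) + 1) *
      (((k + 1 : ℕ) + 1 : ℝ) * besselCoeff α (k + 1 + 1)) * t ^ k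
      = ∑' k : ℕ, (k : ℝ) * (((k : ℝ) + 1) * besselCoeff α (k + 1)) * t ^ k := by
    rw [Summable.tsum_eq_zero_add
      (f := fun k : ℕ => (k : ℝ) * (((k : ℝ) + 1) * besselCoeff α (k + 1)) * t ^ k)]
    · rw [← tsum_mul_left]
      simp only [Nat.cast_zero, zero_mul, zero_add]
      refine tsum_congr fun k => ?_
      push_cast
      ring
    · rw [← summable_nat_add_iff 1]
      refine (s2.mul_left t).congr fun k => ?_
      push_cast
      ring
  rw [e, besselG', besselG, ← tsum_mul_left, ← Summable.tsum_sub (s1.mul_left _) s0]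
  refine tsum_congr fun k => ?_
  have := besselCoeff_succ hα k
  linear_combination t ^ k * this

/-- The kernel `φ(z) = √z J_α(z)` of the Hankel transform. -/
noncomputable def besselKernel (α z : ℝ) : ℝ := Real.sqrt z * besselJ α z

theorem besselKernel_eq (α : ℝ) {z : ℝ} (hz : 0 < z) :
    besselKernel α z = (2 : ℝ) ^ (-α) * (z ^ (α + 1 / 2) * besselG α (z ^ 2 / 4)) := by
  have h : besselJ α z = (z / 2) ^ α * besselG α (z ^ 2 / 4) := by
    rw [besselJ, besselG, ← tsum_mul_left]
    refine tsum_congr fun k => ?_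
    rw [Real.rpow_add (by positivity), besselCoeff, show (2 * (k : ℝ)) = ((2 * k : ℕ) : ℝ) by
      push_cast; rfl, Real.rpow_natCast, pow_mul, show (z / 2) ^ 2 = z ^ 2 / 4 by ring]
    ring
  rw [besselKernel, h, Real.sqrt_eq_rpow, Real.div_rpow hz.le (by norm_num), Real.rpow_add hz,
    Real.rpow_neg (by norm_num)]
  ring

/-- The derivative of `besselKernel α` on `(0,∞)`. -/
noncomputable def besselKernel' (α z : ℝ) : ℝ :=
  (2 : ℝ) ^ (-α) * ((α + 1 / 2) * z ^ (α + 1 / 2 - 1) * besselG α (z ^ 2 / 4) +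
    z ^ (α + 1 / 2) * (besselG' α (z ^ 2 / 4) * (z / 2)))

theorem hasDerivAt_sq_div_four (z : ℝ) : HasDerivAt (fun z : ℝ => z ^ 2 / 4) (z / 2) z := by
  convert! (hasDerivAt_pow 2 z).div_const 4 using 1
  push_cast
  ring

theorem hasDerivAt_besselKernel {α : ℝ} (hα : -1 / 2 ≤ α) {z : ℝ} (hz : 0 < z) :
    HasDerivAt (besselKernel α) (besselKernel' α z) z := by
  have h1 := Real.hasDerivAt_rpow_const (x := z) (p := α + 1 / 2) (Or.inl hz.ne')
  have h2 := (hasDerivAt_besselG hα (z ^ 2 / 4)).comp z (hasDerivAt_sq_div_four z)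
  refine ((h1.mul h2).const_mul ((2 : ℝ) ^ (-α))).congr_of_eventuallyEq ?_
  filter_upwards [Ioi_mem_nhds hz] with w hw
  exact besselKernel_eq α hw

/-- Bessel's equation `φ'' = -(1 + (1/4 - α²)/z²) φ`. -/
theorem hasDerivAt_besselKernel' {α : ℝ} (hα : -1 / 2 ≤ α) {z : ℝ} (hz : 0 < z) :
    HasDerivAt (besselKernel' α) (-(1 + (1 / 4 - α ^ 2) / z ^ 2) * besselKernel α z) z := by
  obtain ⟨g, hg, hode⟩ := exists_hasDerivAt_besselG' hα (z ^ 2 / 4)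
  have h0 := Real.hasDerivAt_rpow_const (x := z) (p := α + 1 / 2) (Or.inl hz.ne')
  have h1 := Real.hasDerivAt_rpow_const (x := z) (p := α + 1 / 2 - 1) (Or.inl hz.ne')
  have h2 := (hasDerivAt_besselG hα (z ^ 2 / 4)).comp z (hasDerivAt_sq_div_four z)
  have h3 := hg.comp z (hasDerivAt_sq_div_four z)
  have h4 : HasDerivAt (fun z : ℝ => z / 2) (1 / 2) z := (hasDerivAt_id z).div_const 2
  have := (((h1.const_mul (α + 1 / 2)).mul h2).add (h0.mul (h3.mul h4))).const_mul
    ((2 : ℝ) ^ (-α))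
  convert! this using 1
  have e1 : z ^ (α + 1 / 2) = z ^ (α + 1 / 2 - 1 - 1) * z ^ 2 := by
    rw [← Real.rpow_natCast, ← Real.rpow_add hz]; congr 1; push_cast; ring
  have e2 : z ^ (α + 1 / 2 - 1) = z ^ (α + 1 / 2 - 1 - 1) * z := by
    conv_rhs => rw [← Real.rpow_add_one hz.ne']
    congr 1; ring
  rw [besselKernel_eq α hz]
  simp only [Function.comp_apply, Pi.mul_apply]
  rw [e1, e2]
  generalize z ^ (α + 1 / 2 - 1 - 1) = r
  field_simp
  linear_combination (-16 * r * z ^ 2) * hode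

theorem continuousOn_besselKernel {α : ℝ} (hα : -1 / 2 ≤ α) :
    ContinuousOn (besselKernel α) (Ioi 0) := fun _ hz =>
  (hasDerivAt_besselKernel hα hz).continuousAt.continuousWithinAt

theorem exists_abs_besselKernel_le_rpow {α : ℝ} (hα : -1 / 2 ≤ α) :
    ∃ A, 0 < A ∧ ∀ z, 0 < z → z ≤ 1 → |besselKernel α z| ≤ A * z ^ (α + 1 / 2) := by
  have hcont : ContinuousOn (fun z : ℝ => besselG α (z ^ 2 / 4)) (Icc 0 1) := fun z _ =>
    (HasDerivAt.comp (h₂ := besselG α) z (hasDerivAt_besselG hα (z ^ 2 / 4))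
      (hasDerivAt_sq_div_four z)).continuousAt.continuousWithinAt
  obtain ⟨D, hD⟩ := isCompact_Icc.exists_bound_of_continuousOn hcont
  refine ⟨(2 : ℝ) ^ (-α) * (|D| + 1), by positivity, fun z hz hz1 => ?_⟩
  rw [besselKernel_eq α hz, abs_mul, abs_mul, abs_of_pos (by positivity : (0 : ℝ) < 2 ^ (-α)),
    abs_of_pos (Real.rpow_pos_of_pos hz _)]
  have := hD z ⟨hz.le, hz1⟩
  rw [Real.norm_eq_abs] at this
  have h2 : |besselG α (z ^ 2 / 4)| ≤ |D| + 1 := by linarith [le_abs_self D]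
  calc (2 : ℝ) ^ (-α) * (z ^ (α + 1 / 2) * |besselG α (z ^ 2 / 4)|)
      ≤ (2 : ℝ) ^ (-α) * (z ^ (α + 1 / 2) * (|D| + 1)) := by gcongr
    _ = _ := by ring

/-- The energy `φ² + φ'²` stays bounded: Bessel's equation bounds its derivative by
`|1/4 - α²| z⁻²` times itself. -/
theorem exists_besselKernel_bound {α : ℝ} (hα : -1 / 2 ≤ α) :
    ∃ M, 0 < M ∧ ∀ z, 1 ≤ z → |besselKernel α z| ≤ M ∧ |besselKernel' α z| ≤ M := by
  set c := |1 / 4 - α ^ 2| with hc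
  set E : ℝ → ℝ := fun z => besselKernel α z ^ 2 + besselKernel' α z ^ 2
  -- `exp (c / z)` is the integrating factor for `E' ≤ c E / z²`, and lies between `1` and `exp c`
  set F : ℝ → ℝ := fun z => E z * Real.exp (c / z)
  have hderiv : ∀ z, 1 ≤ z → ∃ F', HasDerivAt F F' z ∧ F' ≤ 0 := by
    intro z hz
    have hz0 : 0 < z := by linarith
    have h1 := hasDerivAt_besselKernel hα hz0
    have h2 := hasDerivAt_besselKernel' hα hz0
    have h3 : HasDerivAt (fun z : ℝ => c / z) (-c / z ^ 2) z := by
      convert! (hasDerivAt_inv hz0.ne').const_mul c using 1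
      field_simp
    refine ⟨_, ((h1.pow 2).add (h2.pow 2)).mul h3.exp, ?_⟩
    simp only [Pi.add_apply, Pi.pow_apply]
    generalize besselKernel α z = u, besselKernel' α z = v
    have hk : -(1 / 4 - α ^ 2) * (2 * u * v) ≤ c * (u ^ 2 + v ^ 2) := by
      calc -(1 / 4 - α ^ 2) * (2 * u * v) ≤ |-(1 / 4 - α ^ 2) * (2 * u * v)| := le_abs_self _
        _ = c * |2 * u * v| := by rw [abs_mul, abs_neg]
        _ ≤ c * (u ^ 2 + v ^ 2) := by
          gcongr
          rw [abs_le]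
          constructor <;> nlinarith [sq_nonneg (u + v), sq_nonneg (u - v)]
    have e : ((2 : ℕ) * u ^ (2 - 1) * v + (2 : ℕ) * v ^ (2 - 1) *
        (-(1 + (1 / 4 - α ^ 2) / z ^ 2) * u)) * Real.exp (c / z) +
        (u ^ 2 + v ^ 2) * (Real.exp (c / z) * (-c / z ^ 2)) =
        Real.exp (c / z) / z ^ 2 *
          (-(1 / 4 - α ^ 2) * (2 * u * v) - c * (u ^ 2 + v ^ 2)) := by
      field_simp
      push_cast
      ring
    refine le_of_eq_of_le e ?_
    exact mul_nonpos_of_nonneg_of_nonpos (by positivity) (by linarith)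
  have hanti : AntitoneOn F (Ici 1) := by
    refine antitoneOn_of_deriv_nonpos (convex_Ici 1) ?_ ?_ ?_
    · intro z hz
      obtain ⟨_, h, _⟩ := hderiv z hz
      exact h.continuousAt.continuousWithinAt
    · intro z hz
      obtain ⟨_, h, _⟩ := hderiv z (interior_subset hz)
      exact h.differentiableAt.differentiableWithinAt
    · intro z hz
      obtain ⟨_, h, h'⟩ := hderiv z (interior_subset hz)
      rwa [h.deriv]
  refine ⟨Real.sqrt (F 1) + 1, by positivity, fun z hz => ?_⟩
  have hF : F z ≤ F 1 := hanti (mem_Ici.2 le_rfl) (mem_Ici.2 hz) hz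
  have hE : E z ≤ F 1 := by
    refine le_trans ?_ hF
    refine le_mul_of_one_le_right (by positivity) (Real.one_le_exp ?_)
    exact div_nonneg (abs_nonneg _) (by linarith)
  constructor
  · refine (Real.abs_le_sqrt ?_).trans (by linarith : Real.sqrt (F 1) ≤ _)
    exact le_trans (le_add_of_nonneg_right (sq_nonneg _)) hE
  · refine (Real.abs_le_sqrt ?_).trans (by linarith : Real.sqrt (F 1) ≤ _)
    exact le_trans (le_add_of_nonneg_left (sq_nonneg _)) hE

/-- The kernel has bounded integrals over intervals in `[1,∞)`: by Bessel's equation it is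
`-φ''` up to a term of size `z⁻²`. -/
theorem exists_abs_integral_besselKernel_le {α : ℝ} (hα : -1 / 2 ≤ α) :
    ∃ B, 0 < B ∧ ∀ w z, 1 ≤ w → w ≤ z → |∫ u in w..z, besselKernel α u| ≤ B := by
  obtain ⟨M, hM, hb⟩ := exists_besselKernel_bound hα
  set c := |1 / 4 - α ^ 2| with hc
  refine ⟨2 * M + c * M, by positivity, fun w z hw hwz => ?_⟩
  have hpos : ∀ u ∈ Icc w z, 0 < u := fun u hu => by linarith [hu.1]
  have hφ : ContinuousOn (besselKernel α) (Icc w z) :=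
    (continuousOn_besselKernel hα).mono hpos
  have hq : ContinuousOn (fun u => (1 / 4 - α ^ 2) / u ^ 2 * besselKernel α u) (Icc w z) :=
    (continuousOn_const.div (continuousOn_id.pow 2)
      fun u hu => pow_ne_zero 2 (hpos u hu).ne').mul hφ
  have iφ := hφ.intervalIntegrable_of_Icc hwz (μ := volume)
  have iq := hq.intervalIntegrable_of_Icc hwz (μ := volume)
  have hsum : (∫ u in w..z, besselKernel α u) +
      (∫ u in w..z, (1 / 4 - α ^ 2) / u ^ 2 * besselKernel α u)
      = besselKernel' α w - besselKernel' α z := by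
    rw [← intervalIntegral.integral_add iφ iq]
    have := intervalIntegral.integral_eq_sub_of_hasDerivAt
      (f := fun u => -besselKernel' α u)
      (f' := fun u => besselKernel α u + (1 / 4 - α ^ 2) / u ^ 2 * besselKernel α u)
      (a := w) (b := z) (fun u hu => ?_) (iφ.add iq)
    · rw [this]; ring
    · rw [uIcc_of_le hwz] at hu
      convert! (hasDerivAt_besselKernel' hα (hpos u hu)).neg using 1
      ring
  have hqb : |∫ u in w..z, (1 / 4 - α ^ 2) / u ^ 2 * besselKernel α u| ≤ c * M := by
    have hder : ∀ u ∈ uIcc w z, HasDerivAt (fun u : ℝ => -(c * M) / u) (c * M / u ^ 2) u := by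
      intro u hu
      rw [uIcc_of_le hwz] at hu
      convert! (hasDerivAt_inv (hpos u hu).ne').const_mul (-(c * M)) using 1
      field_simp
    have hi : IntervalIntegrable (fun u : ℝ => c * M / u ^ 2) volume w z :=
      ContinuousOn.intervalIntegrable_of_Icc hwz
        (continuousOn_const.div (continuousOn_id.pow 2)
          fun u hu => pow_ne_zero 2 (hpos u hu).ne')
    have h1 := intervalIntegral.norm_integral_le_of_norm_le hwz
      (f := fun u => (1 / 4 - α ^ 2) / u ^ 2 * besselKernel α u) (μ := volume)
      (Filter.Eventually.of_forall fun u hu => ?_) hi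
    · rw [intervalIntegral.integral_eq_sub_of_hasDerivAt hder hi, Real.norm_eq_abs] at h1
      refine h1.trans ?_
      have hw0 : 0 < w := by linarith
      have hz0 : 0 < z := by linarith
      have e1 : c * M / w ≤ c * M := div_le_self (by positivity) hw
      have e2 : 0 ≤ c * M / z := by positivity
      rw [neg_div, neg_div]
      linarith
    · have hu0 : 0 < u := by linarith [hu.1]
      rw [norm_mul, norm_div, norm_pow, Real.norm_eq_abs, Real.norm_eq_abs, Real.norm_eq_abs,
        abs_of_pos hu0, div_mul_eq_mul_div]
      gcongr
      exact (hb u (by linarith [hu.1])).1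
  have a1 := abs_le.1 hqb
  have a2 := abs_le.1 (hb w hw).2
  have a3 := abs_le.1 (hb z (hw.trans hwz)).2
  rw [abs_le]
  constructor <;> linarith [a1.1, a1.2, a2.1, a2.2, a3.1, a3.2]

/-! ### Integrals of functions of bounded variation against an oscillating kernel -/

/-- Abel summation. -/
theorem norm_sum_mul_sub_le {c P : ℕ → ℂ} {B : ℝ} {n : ℕ} (h0 : P 0 = 0)
    (hP : ∀ i ≤ n, ‖P i‖ ≤ B) :
    ‖∑ i ∈ Finset.range n, c i * (P (i + 1) - P i)‖ ≤
      B * (‖c n‖ + ∑ i ∈ Finset.range n, ‖c (i + 1) - c i‖) := by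
  have habel : ∑ i ∈ Finset.range n, c i * (P (i + 1) - P i) =
      c n * P n - ∑ i ∈ Finset.range n, (c (i + 1) - c i) * P (i + 1) := by
    clear hP
    induction n with
    | zero => simp [h0]
    | succ n ih => rw [Finset.sum_range_succ, Finset.sum_range_succ, ih]; ring
  rw [habel, mul_add, Finset.mul_sum]
  refine (norm_sub_le _ _).trans (add_le_add ?_ ((norm_sum_le _ _).trans ?_))
  · rw [norm_mul, mul_comm]
    gcongr
    exact hP n le_rfl
  · refine Finset.sum_le_sum fun i hi => ?_
    rw [norm_mul, mul_comm]
    gcongr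
    exact hP _ (Finset.mem_range.1 hi)

theorem norm_sub_le_variation {f : ℝ → ℂ} {s : Set ℝ} (hf : BoundedVariationOn f s) {x y : ℝ}
    (hx : x ∈ s) (hy : y ∈ s) : ‖f x - f y‖ ≤ (eVariationOn f s).toReal := by
  rw [← dist_eq_norm]
  exact hf.dist_le hx hy

theorem intervalIntegrable_mul_of_boundedVariationOn {f : ℝ → ℂ} {ψ : ℝ → ℝ} {a b : ℝ}
    (hab : a ≤ b) (hf : BoundedVariationOn f (Icc a b))
    (hfm : AEStronglyMeasurable f (volume.restrict (Icc a b))) (hψ : ContinuousOn ψ (Icc a b)) :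
    IntervalIntegrable (fun x => f x * (ψ x : ℂ)) volume a b := by
  have hψc : ContinuousOn (fun x => (ψ x : ℂ)) (uIcc a b) := by
    rw [uIcc_of_le hab]; exact Complex.continuous_ofReal.comp_continuousOn hψ
  refine IntervalIntegrable.mul_continuousOn ?_ hψc
  rw [intervalIntegrable_iff_integrableOn_Icc_of_le hab]
  refine ⟨hfm, HasFiniteIntegral.restrict_of_bounded (‖f a‖ + (eVariationOn f (Icc a b)).toReal)
    (by simp) ?_⟩
  filter_upwards [ae_restrict_mem measurableSet_Icc] with x hx
  have h1 := norm_sub_le_variation hf hx (left_mem_Icc.2 hab)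
  linarith [norm_le_norm_add_norm_sub' (f x) (f a)]

/-- A substitute for Stieltjes integration by parts: a bound for the primitive of `ψ` bounds the
integral of `f ψ` by the total variation of `f`. The step function with the values of `f` at the
nodes of a uniform partition is treated by Abel summation, and the error is at most
`sup |ψ|` times the mesh times the variation. -/
theorem norm_integral_mul_le_of_boundedVariationOn {f : ℝ → ℂ} {ψ : ℝ → ℝ} {a b B : ℝ}
    (hab : a ≤ b) (hf : BoundedVariationOn f (Icc a b))
    (hfm : AEStronglyMeasurable f (volume.restrict (Icc a b)))
    (hψ : ContinuousOn ψ (Icc a b)) (hB : ∀ x ∈ Icc a b, |∫ u in a..x, ψ u| ≤ B) :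
    ‖∫ x in a..b, f x * (ψ x : ℂ)‖ ≤ B * (‖f b‖ + (eVariationOn f (Icc a b)).toReal) := by
  set V := (eVariationOn f (Icc a b)).toReal with hV
  have hB0 : 0 ≤ B := (abs_nonneg _).trans (hB a (left_mem_Icc.2 hab))
  obtain ⟨D, hD⟩ := isCompact_Icc.exists_bound_of_continuousOn hψ
  have hD0 : 0 ≤ D := (norm_nonneg _).trans (hD a (left_mem_Icc.2 hab))
  have key : ∀ n : ℕ, 0 < n →
      ‖∫ x in a..b, f x * (ψ x : ℂ)‖ ≤ B * (‖f b‖ + V) + D * (b - a) * V / n := by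
    intro n hn
    have hn0 : (0 : ℝ) < n := Nat.cast_pos.2 hn
    set δ := (b - a) / n with hδ
    have hδ0 : 0 ≤ δ := div_nonneg (by linarith) hn0.le
    set X : ℕ → ℝ := fun i => a + i * δ with hX
    have hXm : Monotone X := fun i j hij => by
      have : (i : ℝ) ≤ j := Nat.cast_le.2 hij
      simp only [hX]; gcongr
    have hX0 : X 0 = a := by simp [hX]
    have hXn : X n = b := by simp only [hX, hδ]; field_simp; ring
    have hXmem : ∀ i ≤ n, X i ∈ Icc a b := fun i hi =>
      ⟨hX0 ▸ hXm (Nat.zero_le i), hXn ▸ hXm hi⟩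
    have hsub : ∀ i < n, Icc (X i) (X (i + 1)) ⊆ Icc a b := fun i hi =>
      Icc_subset_Icc (hXmem i hi.le).1 (hXmem (i + 1) hi).2
    have hXle : ∀ i, X i ≤ X (i + 1) := fun i => hXm (Nat.le_succ i)
    have hXd : ∀ i, X (i + 1) - X i = δ := fun i => by simp only [hX]; push_cast; ring
    have hint : ∀ i < n, IntervalIntegrable (fun x => f x * (ψ x : ℂ)) volume (X i) (X (i + 1)) :=
      fun i hi => intervalIntegrable_mul_of_boundedVariationOn (hXle i) (hf.mono (hsub i hi))
        (hfm.mono_set (hsub i hi)) (hψ.mono (hsub i hi))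
    have hψint : ∀ x ∈ Icc a b, ∀ y ∈ Icc a b, IntervalIntegrable ψ volume x y :=
      fun x hx y hy => ContinuousOn.intervalIntegrable
        (hψ.mono (ordConnected_Icc.uIcc_subset hx hy))
    set v : ℕ → ℝ := fun i => (eVariationOn f (Icc (X i) (X (i + 1)))).toReal with hv
    have hvsum : ∑ i ∈ Finset.range n, v i = V := by
      rw [hV, ← hX0, ← hXn, ← eVariationOn.sum' f hXm, ENNReal.toReal_sum]
      intro i hi
      exact hf.mono (hsub i (Finset.mem_range.1 hi))
    have hcv : ∀ i < n, ∀ x ∈ Icc (X i) (X (i + 1)), ‖f x - f (X i)‖ ≤ v i := fun i hi x hx =>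
      norm_sub_le_variation (hf.mono (hsub i hi)) hx (left_mem_Icc.2 (hXle i))
    set P : ℕ → ℂ := fun i => ((∫ u in a..X i, ψ u : ℝ) : ℂ) with hP
    have hpiece : ∀ i < n, ∫ x in X i..X (i + 1), f x * (ψ x : ℂ) =
        f (X i) * (P (i + 1) - P i) + ∫ x in X i..X (i + 1), (f x - f (X i)) * (ψ x : ℂ) := by
      intro i hi
      have ha := left_mem_Icc.2 hab
      have h1 : P (i + 1) - P i = ∫ x in X i..X (i + 1), (ψ x : ℂ) := by
        rw [intervalIntegral.integral_ofReal, ← intervalIntegral.integral_interval_sub_left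
          (hψint a ha _ (hXmem (i + 1) hi)) (hψint a ha _ (hXmem i hi.le))]
        simp [hP]
      have h2 : IntervalIntegrable (fun x => f (X i) * (ψ x : ℂ)) volume (X i) (X (i + 1)) :=
        IntervalIntegrable.const_mul
          (have h := hψint _ (hXmem i hi.le) _ (hXmem (i + 1) hi)
          ⟨h.1.ofReal, h.2.ofReal⟩) _
      rw [h1, ← intervalIntegral.integral_const_mul]
      simp_rw [sub_mul]
      rw [intervalIntegral.integral_sub (hint i hi) h2]
      ring
    have herr : ∀ i < n, ‖∫ x in X i..X (i + 1), (f x - f (X i)) * (ψ x : ℂ)‖ ≤ D * δ * v i := by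
      intro i hi
      refine (intervalIntegral.norm_integral_le_of_norm_le_const (C := v i * D)
        fun x hx => ?_).trans_eq ?_
      · rw [uIoc_of_le (hXle i)] at hx
        have hx' := Ioc_subset_Icc_self hx
        rw [norm_mul, Complex.norm_real]
        exact mul_le_mul (hcv i hi x hx') (hD x (hsub i hi hx')) (norm_nonneg _)
          ENNReal.toReal_nonneg
      · rw [hXd, abs_of_nonneg hδ0]; ring
    have hsplit : ∫ x in a..b, f x * (ψ x : ℂ) =
        ∑ i ∈ Finset.range n, f (X i) * (P (i + 1) - P i) +
        ∑ i ∈ Finset.range n, ∫ x in X i..X (i + 1), (f x - f (X i)) * (ψ x : ℂ) := by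
      rw [← Finset.sum_add_distrib, ← hX0, ← hXn,
        ← intervalIntegral.sum_integral_adjacent_intervals fun i hi => hint i hi]
      exact Finset.sum_congr rfl fun i hi => hpiece i (Finset.mem_range.1 hi)
    rw [hsplit]
    refine (norm_add_le _ _).trans (add_le_add ?_ ?_)
    · refine (norm_sum_mul_sub_le (c := fun i => f (X i)) (P := P) (B := B)
        (by simp [hP, hX0]) fun i hi => ?_).trans ?_
      · rw [hP, Complex.norm_real]
        exact hB _ (hXmem i hi)
      · rw [hXn, ← hvsum]
        gcongr with i hi
        exact hcv i (Finset.mem_range.1 hi) _ (right_mem_Icc.2 (hXle i))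
    · refine (norm_sum_le _ _).trans ((Finset.sum_le_sum fun i hi =>
        herr i (Finset.mem_range.1 hi)).trans_eq ?_)
      rw [← Finset.mul_sum, hvsum, hδ]
      ring
  have hlim : Tendsto (fun n : ℕ => B * (‖f b‖ + V) + D * (b - a) * V / n) atTop
      (𝓝 (B * (‖f b‖ + V) + 0)) :=
    tendsto_const_nhds.add (tendsto_const_div_atTop_nhds_zero_nat _)
  rw [add_zero] at hlim
  exact ge_of_tendsto hlim ((eventually_gt_atTop 0).mono key)

/-! ### General monotone functions -/

theorem sum_setLIntegral_Ioc (g : ℝ → ℝ≥0∞) {I : ℕ → ℝ} (hI : Monotone I) (n : ℕ) :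
    ∑ k ∈ Finset.range n, ∫⁻ t in Ioc (I k) (I (k + 1)), g t = ∫⁻ t in Ioc (I 0) (I n), g t := by
  induction n with
  | zero => simp
  | succ n ih =>
    rw [Finset.sum_range_succ, ih, ← Ioc_union_Ioc_eq_Ioc (hI (Nat.zero_le n)) (hI n.le_succ),
      lintegral_union measurableSet_Ioc]
    exact Ioc_disjoint_Ioc_of_le le_rfl

theorem monotone_two_pow_mul {c : ℝ} (hc : 0 < c) : Monotone fun k : ℕ => 2 ^ k * c :=
  fun i j hij => by
    have : (2 : ℝ) ^ i ≤ 2 ^ j := pow_le_pow_right₀ (by norm_num) hij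
    simp only
    gcongr

/-- The intervals `(2^k c, 2^(k+m) c]` cover each point of `(c,∞)` at most `m` times. -/
theorem sum_setLIntegral_dyadic_le (g : ℝ → ℝ≥0∞) {c : ℝ} (hc : 0 < c) (m n : ℕ) :
    ∑ k ∈ Finset.range n, ∫⁻ t in Ioc (2 ^ k * c) (2 ^ (k + m) * c), g t ≤
      m * ∫⁻ t in Ioi c, g t := by
  have hmono := monotone_two_pow_mul hc
  induction m with
  | zero => simp
  | succ m ih =>
    have h1 : ∀ k : ℕ, ∫⁻ t in Ioc (2 ^ k * c) (2 ^ (k + (m + 1)) * c), g t =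
        (∫⁻ t in Ioc (2 ^ k * c) (2 ^ (k + m) * c), g t) +
          ∫⁻ t in Ioc (2 ^ (k + m) * c) (2 ^ (k + 1 + m) * c), g t := by
      intro k
      rw [show k + (m + 1) = k + 1 + m by ring,
        ← Ioc_union_Ioc_eq_Ioc (b := 2 ^ (k + m) * c) (hmono (by omega : k ≤ k + m))
          (hmono (by omega : k + m ≤ k + 1 + m)), lintegral_union measurableSet_Ioc]
      exact Ioc_disjoint_Ioc_of_le le_rfl
    simp_rw [h1]
    rw [Finset.sum_add_distrib, sum_setLIntegral_Ioc g (I := fun k => 2 ^ (k + m) * c)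
      (fun i j hij => hmono (Nat.add_le_add_right hij m)), Nat.cast_add, Nat.cast_one, add_mul,
      one_mul]
    refine add_le_add ih (lintegral_mono_set fun t ht => ?_)
    have h2 := hmono (Nat.zero_le (0 + m))
    simp only [pow_zero, one_mul] at h2
    exact h2.trans_lt ht.1

/-- The variation to the right of `a`, and the value at `a`, of a general monotone function are
controlled by one and the same tail integral of `|f(t)|/t`. The constants depend only on those of
the general monotonicity. -/
theorem exists_variation_le_tail (C : ℝ) {lam : ℝ} (hlam : 0 < lam) :
    ∃ (D : ℝ≥0∞) (r : ℝ), D ≠ ∞ ∧ 1 ≤ r ∧ ∀ f : ℝ → ℂ, IsGMWith C lam f → ∀ a b, 0 < a →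
      eVariationOn f (Icc a b) ≤ D * ∫⁻ t in Ioi (a / r), ‖f t‖ₑ / ENNReal.ofReal t ∧
      ‖f a‖ₑ ≤ D * ∫⁻ t in Ioi (a / r), ‖f t‖ₑ / ENNReal.ofReal t := by
  obtain ⟨m, hm⟩ := pow_unbounded_of_one_lt lam (by norm_num : (1 : ℝ) < 2)
  set r : ℝ := 2 ^ m with hr
  have hr1 : 1 ≤ r := one_le_pow₀ (by norm_num)
  have hr0 : 0 < r := by positivity
  set D₀ : ℝ≥0∞ := ENNReal.ofReal C * ((m + m : ℕ) : ℝ≥0∞) with hD₀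
  have hD₀t : D₀ ≠ ∞ := ENNReal.mul_ne_top ENNReal.ofReal_ne_top (ENNReal.natCast_ne_top _)
  refine ⟨2 + D₀, r, ENNReal.add_ne_top.2 ⟨by simp, hD₀t⟩, hr1, fun f hf a b ha => ?_⟩
  have hda : a / r ≤ a := div_le_self ha.le hr1
  have hda0 : 0 < a / r := by positivity
  set T := ∫⁻ t in Ioi (a / r), ‖f t‖ₑ / ENNReal.ofReal t with hT
  have hvar : ∀ b, eVariationOn f (Icc a b) ≤ D₀ * T := by
    intro b
    obtain ⟨n, hn⟩ := pow_unbounded_of_one_lt (b / a) (by norm_num : (1 : ℝ) < 2)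
    have hb : b ≤ 2 ^ n * a := ((div_lt_iff₀ ha).1 hn).le
    have hmono := monotone_two_pow_mul ha
    calc eVariationOn f (Icc a b) ≤ eVariationOn f (Icc (2 ^ 0 * a) (2 ^ n * a)) :=
          eVariationOn.mono f (by rw [pow_zero, one_mul]; exact Icc_subset_Icc_right hb)
      _ = ∑ k ∈ Finset.range n, eVariationOn f (Icc (2 ^ k * a) (2 ^ (k + 1) * a)) :=
          (eVariationOn.sum' f hmono).symm
      _ ≤ ∑ k ∈ Finset.range n, ENNReal.ofReal C *
            ∫⁻ t in Ioc (2 ^ k * (a / r)) (2 ^ (k + (m + m)) * (a / r)),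
              ‖f t‖ₑ / ENNReal.ofReal t := by
          refine Finset.sum_le_sum fun k _ => ?_
          have hk : 0 < 2 ^ k * a := by positivity
          have h := hf.2 _ hk
          rw [show 2 * (2 ^ k * a) = 2 ^ (k + 1) * a by ring] at h
          refine h.trans ?_
          rw [setLIntegral_congr Ioc_ae_eq_Icc]
          gcongr ENNReal.ofReal C * ∫⁻ t in Icc ?_ ?_, ‖f t‖ₑ / ENNReal.ofReal t
          · rw [← mul_div_assoc]
            gcongr
          · rw [show 2 ^ (k + (m + m)) * (a / r) = r * (2 ^ k * a) by
              rw [hr]; field_simp; ring]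
            gcongr
      _ ≤ D₀ * T := by
          rw [← Finset.mul_sum, hD₀, mul_assoc]
          gcongr
          exact sum_setLIntegral_dyadic_le _ hda0 (m + m) n
  refine ⟨(hvar b).trans (by gcongr; exact le_add_self), ?_⟩
  -- averaging `|f a| ≤ |f t| + Var f` over `t ∈ (a, 2a]`
  have hpt : ‖f a‖ₑ * 2⁻¹ ≤ T + D₀ * T * 2⁻¹ := by
    have hw : ∀ c : ℝ≥0∞, c * 2⁻¹ = ∫⁻ _ in Ioc a (2 * a), c / ENNReal.ofReal (2 * a) := by
      intro c
      have ha' : ENNReal.ofReal a ≠ 0 := by simpa using ha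
      rw [setLIntegral_const, Real.volume_Ioc, show 2 * a - a = a by ring,
        ENNReal.ofReal_mul (by norm_num), ENNReal.ofReal_ofNat, div_eq_mul_inv,
        ENNReal.mul_inv (by simp) (by simp), mul_assoc, mul_assoc,
        ENNReal.inv_mul_cancel ha' ENNReal.ofReal_ne_top, mul_one]
    rw [hw, hw (D₀ * T)]
    calc ∫⁻ _ in Ioc a (2 * a), ‖f a‖ₑ / ENNReal.ofReal (2 * a)
        ≤ ∫⁻ t in Ioc a (2 * a), (‖f t‖ₑ / ENNReal.ofReal t +
            D₀ * T / ENNReal.ofReal (2 * a)) := by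
          refine setLIntegral_mono' measurableSet_Ioc fun t ht => ?_
          have h1 : ‖f a‖ₑ ≤ ‖f t‖ₑ + D₀ * T := by
            have h2 : edist (f a) (f t) ≤ D₀ * T :=
              (eVariationOn.edist_le f (left_mem_Icc.2 (by linarith [ht.1]))
                (Ioc_subset_Icc_self ht)).trans (hvar (2 * a))
            calc ‖f a‖ₑ = ‖f t + (f a - f t)‖ₑ := by congr 1; ring
              _ ≤ ‖f t‖ₑ + ‖f a - f t‖ₑ := enorm_add_le _ _
              _ ≤ _ := by rw [← edist_eq_enorm_sub]; gcongr
          calc ‖f a‖ₑ / ENNReal.ofReal (2 * a)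
              ≤ (‖f t‖ₑ + D₀ * T) / ENNReal.ofReal (2 * a) := by gcongr
            _ = ‖f t‖ₑ / ENNReal.ofReal (2 * a) + D₀ * T / ENNReal.ofReal (2 * a) :=
                ENNReal.add_div
            _ ≤ _ := by gcongr; exact ht.2
      _ = (∫⁻ t in Ioc a (2 * a), ‖f t‖ₑ / ENNReal.ofReal t) +
            ∫⁻ _ in Ioc a (2 * a), D₀ * T / ENNReal.ofReal (2 * a) :=
          lintegral_add_right _ measurable_const
      _ ≤ _ := by
          gcongr
          exact lintegral_mono_set fun t ht => hda.trans_lt ht.1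
  calc ‖f a‖ₑ = 2 * (‖f a‖ₑ * 2⁻¹) := by
        rw [mul_comm, mul_assoc, ENNReal.inv_mul_cancel (by simp) (by simp), mul_one]
    _ ≤ 2 * (T + D₀ * T * 2⁻¹) := by gcongr
    _ = (2 + D₀) * T := by
        rw [mul_add, mul_comm 2 (D₀ * T * 2⁻¹), mul_assoc (D₀ * T),
          ENNReal.inv_mul_cancel (by simp) (by simp), mul_one, add_mul]

/-! ### The Schur test and the Hardy operator -/

/-- Jensen's inequality with respect to a measure of mass at most `W`, given by its density. -/
theorem lintegral_mul_rpow_le {Y : Type*} [MeasurableSpace Y] {ν : Measure Y} {K h : Y → ℝ≥0∞}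
    (hK : AEMeasurable K ν) (hh : AEMeasurable h ν) {W : ℝ≥0∞} (hW : ∫⁻ y, K y ∂ν ≤ W)
    {Q : ℝ} (hQ : 1 ≤ Q) :
    (∫⁻ y, K y * h y ∂ν) ^ Q ≤ W ^ (Q - 1) * ∫⁻ y, K y * h y ^ Q ∂ν := by
  rcases hQ.eq_or_lt with rfl | hQ1
  · simp
  have hQ0 : 0 < Q := by linarith
  have hconj : (Real.conjExponent Q).HolderConjugate Q := (Real.HolderConjugate.conjExponent hQ1).symm
  set P := Real.conjExponent Q with hP
  have hP0 : 0 < P := hconj.pos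
  have hsum : 1 / P + 1 / Q = 1 := by simpa using hconj.inv_add_inv_eq_one
  have hPQ : 1 / P * Q = Q - 1 := by
    rw [eq_sub_of_add_eq hsum, sub_mul, one_mul, div_mul_cancel₀ _ hQ0.ne']
  have hH := ENNReal.lintegral_mul_le_Lp_mul_Lq ν hconj (hK.pow_const (1 / P))
    ((hK.pow_const (1 / Q)).mul hh)
  have e1 : ∀ y, ((fun y => K y ^ (1 / P)) * ((fun y => K y ^ (1 / Q)) * h)) y = K y * h y := by
    intro y
    simp only [Pi.mul_apply]
    rw [← mul_assoc, ← ENNReal.rpow_add_of_nonneg _ _ (by positivity) (by positivity), hsum,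
      ENNReal.rpow_one]
  have e2 : ∀ y, (K y ^ (1 / P)) ^ P = K y := fun y => by
    rw [← ENNReal.rpow_mul, one_div_mul_cancel hP0.ne', ENNReal.rpow_one]
  have e3 : ∀ y, (((fun y => K y ^ (1 / Q)) * h) y) ^ Q = K y * h y ^ Q := fun y => by
    simp only [Pi.mul_apply]
    rw [ENNReal.mul_rpow_of_nonneg _ _ hQ0.le, ← ENNReal.rpow_mul,
      one_div_mul_cancel hQ0.ne', ENNReal.rpow_one]
  simp only [e1, e2, e3] at hH
  calc (∫⁻ y, K y * h y ∂ν) ^ Q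
      ≤ ((∫⁻ y, K y ∂ν) ^ (1 / P) * (∫⁻ y, K y * h y ^ Q ∂ν) ^ (1 / Q)) ^ Q := by gcongr
    _ = (∫⁻ y, K y ∂ν) ^ (Q - 1) * ∫⁻ y, K y * h y ^ Q ∂ν := by
      rw [ENNReal.mul_rpow_of_nonneg _ _ hQ0.le, ← ENNReal.rpow_mul, ← ENNReal.rpow_mul,
        one_div_mul_cancel hQ0.ne', ENNReal.rpow_one, hPQ]
    _ ≤ _ := by
      have : 0 ≤ Q - 1 := by linarith
      gcongr

/-- The Schur test for a kernel whose two marginals are at most `W`. -/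
theorem schur_test {X Y : Type*} [MeasurableSpace X] [MeasurableSpace Y] {μ : Measure X}
    {ν : Measure Y} [SFinite μ] [SFinite ν] {K : X → Y → ℝ≥0∞}
    (hK : Measurable (Function.uncurry K)) {h : Y → ℝ≥0∞} (hh : AEMeasurable h ν) {W : ℝ≥0∞}
    (hW₁ : ∀ᵐ x ∂μ, ∫⁻ y, K x y ∂ν ≤ W) (hW₂ : ∀ᵐ y ∂ν, ∫⁻ x, K x y ∂μ ≤ W)
    {Q : ℝ} (hQ : 1 ≤ Q) :
    ∫⁻ x, (∫⁻ y, K x y * h y ∂ν) ^ Q ∂μ ≤ W ^ Q * ∫⁻ y, h y ^ Q ∂ν := by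
  have hm : AEMeasurable (Function.uncurry fun x y => K x y * h y ^ Q) (μ.prod ν) :=
    hK.aemeasurable.mul (hh.comp_snd.pow_const Q)
  calc ∫⁻ x, (∫⁻ y, K x y * h y ∂ν) ^ Q ∂μ
      ≤ ∫⁻ x, W ^ (Q - 1) * ∫⁻ y, K x y * h y ^ Q ∂ν ∂μ := by
        refine lintegral_mono_ae (hW₁.mono fun x hx => ?_)
        exact lintegral_mul_rpow_le hK.of_uncurry_left.aemeasurable hh hx hQ
    _ = W ^ (Q - 1) * ∫⁻ y, ∫⁻ x, K x y * h y ^ Q ∂μ ∂ν := by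
        have hm' : AEMeasurable (fun x => ∫⁻ y, K x y * h y ^ Q ∂ν) μ := hm.lintegral_prod_right'
        rw [lintegral_const_mul'' _ hm', lintegral_lintegral_swap hm]
    _ ≤ W ^ (Q - 1) * ∫⁻ y, W * h y ^ Q ∂ν := by
        refine mul_le_mul_right (lintegral_mono_ae (hW₂.mono fun y hy => ?_)) _
        rw [lintegral_mul_const _ hK.of_uncurry_right]
        gcongr
    _ = W ^ Q * ∫⁻ y, h y ^ Q ∂ν := by
        rw [lintegral_const_mul'' _ (hh.pow_const Q), ← mul_assoc]
        congr 1
        conv_lhs => rw [← ENNReal.rpow_one W, ← ENNReal.rpow_mul, one_mul]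
        rw [← ENNReal.rpow_add_of_nonneg _ _ (by linarith) zero_le_one, sub_add_cancel]

/-- The Haar measure `dx/x` of the multiplicative group `(0,∞)`. -/
noncomputable def haarIoi : Measure ℝ :=
  (volume.restrict (Ioi 0)).withDensity fun x => ENNReal.ofReal x⁻¹

instance : SFinite haarIoi := by unfold haarIoi; infer_instance

theorem lintegral_haarIoi (g : ℝ → ℝ≥0∞) :
    ∫⁻ x, g x ∂haarIoi = ∫⁻ x in Ioi 0, ENNReal.ofReal x⁻¹ * g x :=
  lintegral_withDensity_eq_lintegral_mul_non_measurable _ (by fun_prop)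
    (Eventually.of_forall fun _ => ENNReal.ofReal_lt_top) g

theorem haarIoi_ac : haarIoi ≪ volume.restrict (Ioi 0) := withDensity_absolutelyContinuous _ _

theorem ae_haarIoi_pos : ∀ᵐ x ∂haarIoi, 0 < x :=
  haarIoi_ac.ae_le (ae_restrict_mem measurableSet_Ioi)

/-- The operator `g ↦ ∫₀^∞ g(u) min((uy)^β, 1) du/u`, which dominates `y |H_α f(y)|` when
`g = |f|` and `β = α + 3/2`. -/
noncomputable def hardyOp (β : ℝ) (g : ℝ → ℝ≥0∞) (y : ℝ) : ℝ≥0∞ :=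
  ∫⁻ u, g u * ENNReal.ofReal (min ((u * y) ^ β) 1) ∂haarIoi

/-- The mass of `min(z^β, 1) z^(-s)` with respect to `dz/z`. -/
noncomputable def hardyConst (β s : ℝ) : ℝ := 1 / (β - s) + 1 / s

theorem lintegral_hardyKernel_le {β s : ℝ} (hs : 0 < s) (hsβ : s < β) {y : ℝ} (hy : 0 < y) :
    ∫⁻ u, ENNReal.ofReal (min ((u * y) ^ β) 1 * (u * y) ^ (-s)) ∂haarIoi ≤
      ENNReal.ofReal (hardyConst β s) := by
  have hc : 0 < 1 / y := by positivity
  rw [lintegral_haarIoi, ← Ioc_union_Ioi_eq_Ioi hc.le, hardyConst,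
    ENNReal.ofReal_add (by have := sub_pos.2 hsβ; positivity) (by positivity)]
  refine (lintegral_union_le _ _ _).trans (add_le_add ?_ ?_)
  · have hi : IntegrableOn (fun u : ℝ => y ^ (β - s) * u ^ (β - s - 1)) (Ioc 0 (1 / y)) :=
      ((intervalIntegrable_iff_integrableOn_Ioc_of_le hc.le).1
        (intervalIntegral.intervalIntegrable_rpow' (by linarith))).const_mul _
    calc _ ≤ ∫⁻ u in Ioc 0 (1 / y), ENNReal.ofReal (y ^ (β - s) * u ^ (β - s - 1)) := by
          refine setLIntegral_mono' measurableSet_Ioc fun u hu => ?_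
          have hu0 := hu.1
          rw [← ENNReal.ofReal_mul (by positivity)]
          apply ENNReal.ofReal_le_ofReal
          calc u⁻¹ * (min ((u * y) ^ β) 1 * (u * y) ^ (-s))
              ≤ u⁻¹ * ((u * y) ^ β * (u * y) ^ (-s)) := by
                gcongr; exact min_le_left _ _
            _ = y ^ (β - s) * u ^ (β - s - 1) := by
                rw [← Real.rpow_add (by positivity), Real.mul_rpow hu0.le hy.le,
                  Real.rpow_sub_one hu0.ne', ← sub_eq_add_neg]
                ring
      _ = ENNReal.ofReal (1 / (β - s)) := by
          rw [← ofReal_integral_eq_lintegral_ofReal hi, integral_const_mul,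
            ← intervalIntegral.integral_of_le hc.le, integral_rpow (Or.inl (by linarith))]
          · congr 1
            have h1 : 0 < β - s := sub_pos.2 hsβ
            rw [sub_add_cancel, Real.zero_rpow h1.ne', Real.div_rpow zero_le_one hy.le,
              Real.one_rpow]
            field_simp
            ring
          · filter_upwards [ae_restrict_mem measurableSet_Ioc] with u hu
            have hu0 := hu.1
            simp only [Pi.zero_apply]
            positivity
      _ ≤ _ := le_rfl
  · have hi : IntegrableOn (fun u : ℝ => y ^ (-s) * u ^ (-s - 1)) (Ioi (1 / y)) :=
      (integrableOn_Ioi_rpow_of_lt (by linarith) hc).const_mul _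
    calc _ ≤ ∫⁻ u in Ioi (1 / y), ENNReal.ofReal (y ^ (-s) * u ^ (-s - 1)) := by
          refine setLIntegral_mono' measurableSet_Ioi fun u hu => ?_
          have hu0 : 0 < u := hc.trans hu
          rw [← ENNReal.ofReal_mul (by positivity)]
          apply ENNReal.ofReal_le_ofReal
          calc u⁻¹ * (min ((u * y) ^ β) 1 * (u * y) ^ (-s))
              ≤ u⁻¹ * (1 * (u * y) ^ (-s)) := by gcongr; exact min_le_right _ _
            _ = y ^ (-s) * u ^ (-s - 1) := by
                rw [Real.mul_rpow hu0.le hy.le, Real.rpow_sub_one hu0.ne']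
                ring
      _ = ENNReal.ofReal (1 / s) := by
          rw [← ofReal_integral_eq_lintegral_ofReal hi, integral_const_mul,
            integral_Ioi_rpow_of_lt (by linarith) hc]
          · congr 1
            rw [sub_add_cancel, Real.div_rpow zero_le_one hy.le, Real.one_rpow]
            field_simp
          · filter_upwards [ae_restrict_mem measurableSet_Ioi] with u hu
            have hu0 : 0 < u := hc.trans hu
            simp only [Pi.zero_apply]
            positivity
      _ ≤ _ := le_rfl

/-- Moving the weights `u^s` and `y^(-s)` into the kernel. -/
theorem rpow_mul_hardyOp (β s : ℝ) (g : ℝ → ℝ≥0∞) {y : ℝ} (hy : 0 < y) :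
    ENNReal.ofReal (y ^ (-s)) * hardyOp β g y =
      ∫⁻ u, ENNReal.ofReal (min ((u * y) ^ β) 1 * (u * y) ^ (-s)) *
        (ENNReal.ofReal (u ^ s) * g u) ∂haarIoi := by
  rw [hardyOp, ← lintegral_const_mul' _ _ ENNReal.ofReal_ne_top]
  refine lintegral_congr_ae (ae_haarIoi_pos.mono fun u hu => ?_)
  have h1 : (0 : ℝ) ≤ min ((u * y) ^ β) 1 := by positivity
  have e : y ^ (-s) = (u * y) ^ (-s) * u ^ s := by
    rw [Real.mul_rpow hu.le hy.le, mul_right_comm, ← Real.rpow_add hu, neg_add_cancel,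
      Real.rpow_zero, one_mul]
  simp only
  rw [e, ENNReal.ofReal_mul h1, ENNReal.ofReal_mul (by positivity)]
  ring

theorem ofReal_rpow_mul_rpow {x s Q t : ℝ} (hx : 0 < x) (hQ : 0 ≤ Q) (ht : t = Q * s - 1)
    (a : ℝ≥0∞) : ENNReal.ofReal (x ^ t) * a ^ Q =
      ENNReal.ofReal x⁻¹ * (ENNReal.ofReal (x ^ s) * a) ^ Q := by
  rw [ENNReal.mul_rpow_of_nonneg _ _ hQ, ENNReal.ofReal_rpow_of_nonneg (by positivity) hQ,
    ← Real.rpow_mul hx.le, ← mul_assoc, ← ENNReal.ofReal_mul (by positivity), ht,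
    Real.rpow_sub_one hx.ne']
  congr 2
  rw [mul_comm s Q]
  ring

/-- The norm of `L^q_{t(p,q)}` for `q < ∞`, on the multiplicative group. -/
theorem tNorm_of_ne_top {q : ℝ≥0∞} (hq : q ≠ ∞) (s : ℝ) (f : ℝ → ℂ) :
    tNorm s q f =
      (∫⁻ x, (ENNReal.ofReal (x ^ s) * ‖f x‖ₑ) ^ q.toReal ∂haarIoi) ^ (1 / q.toReal) := by
  rw [tNorm, weightedNorm, if_neg hq, lintegral_haarIoi]
  congr 1
  refine setLIntegral_congr_fun measurableSet_Ioi fun x hx => ?_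
  simp only [tWeight, if_neg hq]
  exact ofReal_rpow_mul_rpow hx ENNReal.toReal_nonneg rfl _

theorem tNorm_top (s : ℝ) (f : ℝ → ℂ) :
    tNorm s ∞ f = ⨆ x ∈ Ioi (0 : ℝ), ENNReal.ofReal (x ^ s) * ‖f x‖ₑ := by
  simp [tNorm, weightedNorm, tWeight]

theorem le_tNorm_top (s : ℝ) (f : ℝ → ℂ) {x : ℝ} (hx : 0 < x) :
    ENNReal.ofReal (x ^ s) * ‖f x‖ₑ ≤ tNorm s ∞ f := by
  rw [tNorm_top]
  exact le_iSup₂ (f := fun x (_ : x ∈ Ioi (0 : ℝ)) => ENNReal.ofReal (x ^ s) * ‖f x‖ₑ) x hx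

theorem rpow_mul_hardyOp_le_tNorm_top {β s : ℝ} (hs : 0 < s) (hsβ : s < β) (f : ℝ → ℂ) {y : ℝ}
    (hy : 0 < y) : ENNReal.ofReal (y ^ (-s)) * hardyOp β (fun u => ‖f u‖ₑ) y ≤
      ENNReal.ofReal (hardyConst β s) * tNorm s ∞ f := by
  rw [rpow_mul_hardyOp β s _ hy]
  calc _ ≤ ∫⁻ u, ENNReal.ofReal (min ((u * y) ^ β) 1 * (u * y) ^ (-s)) * tNorm s ∞ f ∂haarIoi :=
        lintegral_mono_ae (ae_haarIoi_pos.mono fun u hu =>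
          mul_le_mul_right (le_tNorm_top s f hu) _)
    _ ≤ _ := by
        rw [lintegral_mul_const _ (by fun_prop)]
        gcongr
        exact lintegral_hardyKernel_le hs hsβ hy

theorem lintegral_hardyOp_rpow_le {β s : ℝ} (hs : 0 < s) (hsβ : s < β) {f : ℝ → ℂ}
    (hf : AEStronglyMeasurable f (volume.restrict (Ioi 0))) {Q : ℝ} (hQ : 1 ≤ Q) :
    ∫⁻ y, (ENNReal.ofReal (y ^ (-s)) * hardyOp β (fun u => ‖f u‖ₑ) y) ^ Q ∂haarIoi ≤
      ENNReal.ofReal (hardyConst β s) ^ Q *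
        ∫⁻ x, (ENNReal.ofReal (x ^ s) * ‖f x‖ₑ) ^ Q ∂haarIoi := by
  have hW : ∀ᵐ y ∂haarIoi, ∫⁻ u, ENNReal.ofReal (min ((u * y) ^ β) 1 * (u * y) ^ (-s)) ∂haarIoi ≤
      ENNReal.ofReal (hardyConst β s) :=
    ae_haarIoi_pos.mono fun y hy => lintegral_hardyKernel_le hs hsβ hy
  have h := schur_test (μ := haarIoi) (ν := haarIoi)
    (K := fun y u => ENNReal.ofReal (min ((u * y) ^ β) 1 * (u * y) ^ (-s)))
    (h := fun u => ENNReal.ofReal (u ^ s) * ‖f u‖ₑ) (by unfold Function.uncurry; fun_prop)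
    ((by fun_prop : Measurable fun u : ℝ => ENNReal.ofReal (u ^ s)).aemeasurable.mul
      (hf.mono_ac haarIoi_ac).enorm) hW (by simpa only [mul_comm] using hW) hQ
  refine le_of_eq_of_le (lintegral_congr_ae (ae_haarIoi_pos.mono fun y hy => ?_)) h
  simp only
  rw [rpow_mul_hardyOp β s _ hy]

/-- The weights for the exponents `p` and `p'` match because `y^(1-s) y⁻¹ = y^(-s)`. For `q = ∞`
the norm is a genuine supremum, so the bound on `F` is needed at every point. -/
theorem tNorm_le_of_le_hardyOp {β s : ℝ} (hs : 0 < s) (hsβ : s < β) {q : ℝ≥0∞} (hq : 1 ≤ q)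
    {f F : ℝ → ℂ} (hf : AEStronglyMeasurable f (volume.restrict (Ioi 0))) {A : ℝ≥0∞}
    (hA : A ≠ ∞)
    (hF : ∀ y, 0 < y → ‖F y‖ₑ ≤ A * (ENNReal.ofReal y⁻¹ * hardyOp β (fun u => ‖f u‖ₑ) y)) :
    tNorm (1 - s) q F ≤ A * ENNReal.ofReal (hardyConst β s) * tNorm s q f := by
  have hF' : ∀ y, 0 < y → ENNReal.ofReal (y ^ (1 - s)) * ‖F y‖ₑ ≤
      A * (ENNReal.ofReal (y ^ (-s)) * hardyOp β (fun u => ‖f u‖ₑ) y) := by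
    intro y hy
    have e : y ^ (-s) = y ^ (1 - s) * y⁻¹ := by
      rw [← div_eq_mul_inv, ← Real.rpow_sub_one hy.ne']; congr 1; ring
    rw [e, ENNReal.ofReal_mul (by positivity)]
    calc _ ≤ ENNReal.ofReal (y ^ (1 - s)) *
          (A * (ENNReal.ofReal y⁻¹ * hardyOp β (fun u => ‖f u‖ₑ) y)) := by
            gcongr; exact hF y hy
      _ = _ := by ring
  by_cases hqt : q = ∞
  · subst hqt
    rw [tNorm_top]
    refine iSup₂_le fun y hy => (hF' y hy).trans ?_
    rw [mul_assoc]
    exact mul_le_mul_right (rpow_mul_hardyOp_le_tNorm_top hs hsβ f hy) _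
  · have hQ : 1 ≤ q.toReal := by
      simpa using ENNReal.toReal_mono hqt hq
    have hQ0 : 0 < q.toReal := by linarith
    rw [tNorm_of_ne_top hqt, tNorm_of_ne_top hqt]
    calc _ ≤ (∫⁻ y, A ^ q.toReal * (ENNReal.ofReal (y ^ (-s)) *
            hardyOp β (fun u => ‖f u‖ₑ) y) ^ q.toReal ∂haarIoi) ^ (1 / q.toReal) := by
          gcongr ?_ ^ _
          refine lintegral_mono_ae (ae_haarIoi_pos.mono fun y hy => ?_)
          rw [← ENNReal.mul_rpow_of_nonneg _ _ hQ0.le]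
          exact ENNReal.rpow_le_rpow (hF' y hy) hQ0.le
      _ ≤ (A ^ q.toReal * (ENNReal.ofReal (hardyConst β s) ^ q.toReal *
            ∫⁻ x, (ENNReal.ofReal (x ^ s) * ‖f x‖ₑ) ^ q.toReal ∂haarIoi)) ^ (1 / q.toReal) := by
          rw [lintegral_const_mul' _ _ (ENNReal.rpow_ne_top_of_nonneg hQ0.le hA)]
          gcongr
          exact lintegral_hardyOp_rpow_le hs hsβ hf hQ
      _ = _ := by
          rw [← mul_assoc, ← ENNReal.mul_rpow_of_nonneg _ _ hQ0.le,
            ENNReal.mul_rpow_of_nonneg _ _ (by positivity), ← ENNReal.rpow_mul,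
            mul_one_div_cancel hQ0.ne', ENNReal.rpow_one]

/-- Finiteness of `hardyOp β g` at one point implies finiteness at all points, since dilating the
kernel changes it by at most a constant factor. -/
theorem hardyOp_eq_top {β : ℝ} {g : ℝ → ℝ≥0∞} {x y : ℝ} (hx : 0 < x) (hy : 0 < y)
    (h : hardyOp β g x = ∞) : hardyOp β g y = ∞ := by
  have hle : hardyOp β g x ≤ ENNReal.ofReal (max ((x / y) ^ β) 1) * hardyOp β g y := by
    rw [hardyOp, hardyOp, ← lintegral_const_mul' _ _ ENNReal.ofReal_ne_top]
    refine lintegral_mono_ae (ae_haarIoi_pos.mono fun u hu => ?_)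
    rw [mul_left_comm, ← ENNReal.ofReal_mul (by positivity)]
    gcongr
    have e : (u * x) ^ β = (x / y) ^ β * (u * y) ^ β := by
      rw [← Real.mul_rpow (by positivity) (by positivity)]
      congr 1
      field_simp
    rw [mul_min_of_nonneg _ _ (by positivity), mul_one, e]
    gcongr
    · exact le_max_left _ _
    · exact le_max_right _ _
  by_contra hne
  exact (ENNReal.mul_ne_top ENNReal.ofReal_ne_top hne) (top_le_iff.1 (h ▸ hle))

/-- For `q < ∞` the norm inequality excludes that `hardyOp` is infinite everywhere. -/
theorem hardyOp_ne_top {β s : ℝ} (hs : 0 < s) (hsβ : s < β) {q : ℝ≥0∞} (hq : 1 ≤ q)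
    {f : ℝ → ℂ} (hf : MemT s q f) {y : ℝ} (hy : 0 < y) : hardyOp β (fun u => ‖f u‖ₑ) y ≠ ∞ := by
  intro htop
  by_cases hqt : q = ∞
  · subst hqt
    have h := rpow_mul_hardyOp_le_tNorm_top hs hsβ f hy
    have h0 : ENNReal.ofReal (y ^ (-s)) ≠ 0 := by
      simpa using Real.rpow_pos_of_pos hy _
    rw [htop, ENNReal.mul_top h0, top_le_iff] at h
    exact ENNReal.mul_ne_top ENNReal.ofReal_ne_top hf.2.ne h
  · have hQ : 1 ≤ q.toReal := by
      simpa using ENNReal.toReal_mono hqt hq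
    have hQ0 : 0 < q.toReal := by linarith
    have h := lintegral_hardyOp_rpow_le hs hsβ hf.1 hQ
    have hfin := hf.2
    rw [tNorm_of_ne_top hqt] at hfin
    have hfin' : ∫⁻ x, (ENNReal.ofReal (x ^ s) * ‖f x‖ₑ) ^ q.toReal ∂haarIoi ≠ ∞ := fun h' => by
      rw [h', ENNReal.top_rpow_of_pos (by positivity)] at hfin
      exact lt_irrefl _ hfin
    refine ENNReal.mul_ne_top (ENNReal.rpow_ne_top_of_nonneg hQ0.le ENNReal.ofReal_ne_top) hfin'
      (top_le_iff.1 (le_trans ?_ h))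
    rw [lintegral_haarIoi]
    calc (∞ : ℝ≥0∞) = ∫⁻ _ in Ioi (0 : ℝ), ∞ := by simp
      _ ≤ _ := by
        refine setLIntegral_mono' measurableSet_Ioi fun z hz => ?_
        have hz0 : 0 < z := hz
        have h1 : ENNReal.ofReal (z ^ (-s)) ≠ 0 := by simpa using Real.rpow_pos_of_pos hz0 _
        have h2 : ENNReal.ofReal z⁻¹ ≠ 0 := by simpa using hz0
        rw [hardyOp_eq_top hy hz0 htop, ENNReal.mul_top h1,
          ENNReal.top_rpow_of_pos hQ0, ENNReal.mul_top h2]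

/-! ### The Hankel transform of a general monotone function -/

theorem hankelIntegrand_eq (α : ℝ) (f : ℝ → ℂ) (y x : ℝ) :
    hankelIntegrand α f y x = f x * (besselKernel α (x * y) : ℂ) := rfl

theorem tendsto_lintegral_Ioi_atTop {g : ℝ → ℝ≥0∞} {a : ℝ} (h : ∫⁻ t in Ioi a, g t ≠ ∞) :
    Tendsto (fun x => ∫⁻ t in Ioi x, g t) atTop (𝓝 0) := by
  have h1 := tendsto_measure_iInter_atTop (μ := volume.withDensity g) (s := fun x : ℝ => Ioi x)
    (fun _ => measurableSet_Ioi.nullMeasurableSet) (fun _ _ hxy => Ioi_subset_Ioi hxy)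
    ⟨a, by rwa [withDensity_apply _ measurableSet_Ioi]⟩
  have h2 : ⋂ x : ℝ, Ioi x = ∅ := by
    ext t
    simp only [mem_iInter, mem_Ioi, mem_empty_iff_false, iff_false, not_forall, not_lt]
    exact ⟨t, le_rfl⟩
  rw [h2, measure_empty] at h1
  refine h1.congr fun x => ?_
  simp only [Function.comp_apply]
  rw [withDensity_apply _ measurableSet_Ioi]

/-- The part of `hardyOp` where `u y ≥ 1/r` dominates the tail integral of `g(t)/t`. -/
theorem lintegral_tail_le_hardyOp {β : ℝ} (hβ : 0 < β) (g : ℝ → ℝ≥0∞) {r y : ℝ} (hr : 1 ≤ r)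
    (hy : 0 < y) : ∫⁻ t in Ioi (y⁻¹ / r), g t / ENNReal.ofReal t ≤
      ENNReal.ofReal (r ^ β) * hardyOp β g y := by
  have hr0 : 0 < r := by linarith
  have hc : 0 < y⁻¹ / r := by positivity
  rw [hardyOp, lintegral_haarIoi, ← lintegral_const_mul' _ _ ENNReal.ofReal_ne_top]
  refine le_trans (setLIntegral_mono' measurableSet_Ioi fun t ht => ?_)
    (lintegral_mono_set (Ioi_subset_Ioi hc.le))
  have ht0 : 0 < t := hc.trans ht
  have h1 : 1 ≤ r * (t * y) := by
    have : y⁻¹ / r < t := ht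
    rw [div_lt_iff₀ hr0, inv_lt_iff_one_lt_mul₀ hy] at this
    linarith
  have h2 : 1 ≤ r ^ β * min ((t * y) ^ β) 1 := by
    rw [mul_min_of_nonneg _ _ (by positivity), mul_one, ← Real.mul_rpow hr0.le (by positivity)]
    exact le_min (Real.one_le_rpow h1 hβ.le) (Real.one_le_rpow hr hβ.le)
  calc g t / ENNReal.ofReal t = 1 * (ENNReal.ofReal t⁻¹ * g t) := by
        rw [ENNReal.ofReal_inv_of_pos ht0, one_mul, mul_comm, div_eq_mul_inv]
    _ ≤ ENNReal.ofReal (r ^ β * min ((t * y) ^ β) 1) * (ENNReal.ofReal t⁻¹ * g t) := by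
        gcongr
        rwa [ENNReal.one_le_ofReal]
    _ = _ := by rw [ENNReal.ofReal_mul (by positivity)]; ring

theorem lintegral_head_le_hardyOp {α A : ℝ} (hβ : 0 < α + 3 / 2) (hA : 0 < A)
    (hbd : ∀ z, 0 < z → z ≤ 1 → |besselKernel α z| ≤ A * z ^ (α + 1 / 2)) (f : ℝ → ℂ) {y : ℝ}
    (hy : 0 < y) : ∫⁻ x in Ioc 0 y⁻¹, ‖hankelIntegrand α f y x‖ₑ ≤
      ENNReal.ofReal A * (ENNReal.ofReal y⁻¹ * hardyOp (α + 3 / 2) (fun u => ‖f u‖ₑ) y) := by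
  rw [hardyOp, lintegral_haarIoi, ← lintegral_const_mul' _ _ ENNReal.ofReal_ne_top,
    ← lintegral_const_mul' _ _ ENNReal.ofReal_ne_top]
  refine le_trans (setLIntegral_mono' measurableSet_Ioc fun x hx => ?_)
    (lintegral_mono_set Ioc_subset_Ioi_self)
  have hx0 := hx.1
  have hz : 0 < x * y := by positivity
  have hz1 : x * y ≤ 1 := by
    have := mul_le_mul_of_nonneg_right hx.2 hy.le
    rwa [inv_mul_cancel₀ hy.ne'] at this
  have hpt : |besselKernel α (x * y)| ≤ A * (y⁻¹ * (x⁻¹ * min ((x * y) ^ (α + 3 / 2)) 1)) := by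
    rw [min_eq_left (Real.rpow_le_one hz.le hz1 hβ.le),
      show α + 3 / 2 = α + 1 / 2 + 1 by ring, Real.rpow_add_one hz.ne']
    refine (hbd _ hz hz1).trans_eq ?_
    field_simp
  rw [hankelIntegrand_eq, enorm_mul, ← ofReal_norm (besselKernel α (x * y) : ℂ),
    Complex.norm_real, Real.norm_eq_abs]
  calc ‖f x‖ₑ * ENNReal.ofReal |besselKernel α (x * y)|
      ≤ ‖f x‖ₑ * ENNReal.ofReal (A * (y⁻¹ * (x⁻¹ * min ((x * y) ^ (α + 3 / 2)) 1))) := by gcongr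
    _ = _ := by
      rw [ENNReal.ofReal_mul hA.le, ENNReal.ofReal_mul (by positivity),
        ENNReal.ofReal_mul (by positivity)]
      ring

section

variable {α C lam : ℝ} {f : ℝ → ℂ}

theorem IsGMWith.boundedVariationOn_Icc (hf : IsGMWith C lam f) {a b : ℝ} (ha : 0 < a) :
    BoundedVariationOn f (Icc a b) := by
  rcases le_or_gt a b with hab | hab
  · have := hf.1 a b ha (ha.trans_le hab)
    have hsub : Icc a b ⊆ Ioi 0 := fun x hx => ha.trans_le hx.1
    rwa [inter_eq_right.2 hsub] at this
  · rw [Icc_eq_empty hab.not_ge]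
    simp [BoundedVariationOn]

theorem continuousOn_besselKernel_mul (hα : -1 / 2 ≤ α) {y : ℝ} (hy : 0 < y) :
    ContinuousOn (fun x => besselKernel α (x * y)) (Ioi 0) :=
  (continuousOn_besselKernel hα).comp (by fun_prop) fun _ hx => mul_pos hx hy

theorem IsGMWith.intervalIntegrable_hankelIntegrand (hα : -1 / 2 ≤ α) (hf : IsGMWith C lam f)
    (hfm : AEStronglyMeasurable f (volume.restrict (Ioi 0))) {y M N : ℝ} (hy : 0 < y) (hM : 0 < M)
    (hMN : M ≤ N) : IntervalIntegrable (hankelIntegrand α f y) volume M N := by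
  have hsub : Icc M N ⊆ Ioi 0 := fun x hx => hM.trans_le hx.1
  exact intervalIntegrable_mul_of_boundedVariationOn hMN (hf.boundedVariationOn_Icc hM)
    (hfm.mono_set hsub) ((continuousOn_besselKernel_mul hα hy).mono hsub)

/-- Away from the origin the bounded primitive of the kernel is played against the variation
of `f`. -/
theorem IsGMWith.enorm_integral_hankelIntegrand_le (hα : -1 / 2 ≤ α) (hf : IsGMWith C lam f)
    (hfm : AEStronglyMeasurable f (volume.restrict (Ioi 0))) {B : ℝ}
    (hB : ∀ w z, 1 ≤ w → w ≤ z → |∫ u in w..z, besselKernel α u| ≤ B)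
    {y M N : ℝ} (hy : 0 < y) (hM : y⁻¹ ≤ M) (hMN : M ≤ N) :
    ‖∫ x in M..N, hankelIntegrand α f y x‖ₑ ≤
      ENNReal.ofReal B * (ENNReal.ofReal y⁻¹ * (‖f N‖ₑ + eVariationOn f (Icc M N))) := by
  have hM0 : 0 < M := (inv_pos.2 hy).trans_le hM
  have hsub : Icc M N ⊆ Ioi 0 := fun x hx => hM0.trans_le hx.1
  have hbv := hf.boundedVariationOn_Icc (b := N) hM0
  have hMy : 1 ≤ M * y := by
    have := mul_le_mul_of_nonneg_right hM hy.le
    rwa [inv_mul_cancel₀ hy.ne'] at this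
  have h := norm_integral_mul_le_of_boundedVariationOn (B := B * y⁻¹) hMN hbv (hfm.mono_set hsub)
    ((continuousOn_besselKernel_mul hα hy).mono hsub) fun x hx => by
      rw [intervalIntegral.integral_comp_mul_right _ hy.ne', smul_eq_mul, abs_mul,
        abs_of_pos (inv_pos.2 hy), mul_comm]
      gcongr
      exact hB _ _ hMy (by gcongr; exact hx.1)
  have hB0 : 0 ≤ B := (abs_nonneg _).trans (hB 1 1 le_rfl le_rfl)
  rw [← ofReal_norm, ← mul_assoc, ← ENNReal.ofReal_mul hB0, ← ofReal_norm,
    ← ENNReal.ofReal_toReal hbv, ← ENNReal.ofReal_add (norm_nonneg _) ENNReal.toReal_nonneg,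
    ← ENNReal.ofReal_mul (by positivity)]
  exact ENNReal.ofReal_le_ofReal h

/-- Existence of the Hankel transform, and the pointwise estimate `y |H_α f(y)| ≲ hardyOp |f| y`:
the integrals near `0` converge absolutely, those near `∞` by bounded variation. -/
theorem exists_hankel_le_hardyOp (hα : -1 / 2 ≤ α) (C : ℝ) {lam : ℝ} (hlam : 0 < lam) :
    ∃ A : ℝ≥0∞, A ≠ ∞ ∧ ∀ f : ℝ → ℂ, IsGMWith C lam f →
      AEStronglyMeasurable f (volume.restrict (Ioi 0)) → ∀ y, 0 < y →
      hardyOp (α + 3 / 2) (fun u => ‖f u‖ₑ) y ≠ ∞ →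
      ∃ L, HasHankelIntegral α f y L ∧
        ‖L‖ₑ ≤ A * (ENNReal.ofReal y⁻¹ * hardyOp (α + 3 / 2) (fun u => ‖f u‖ₑ) y) := by
  obtain ⟨A, hA, hbd⟩ := exists_abs_besselKernel_le_rpow hα
  obtain ⟨B, hB0, hB⟩ := exists_abs_integral_besselKernel_le hα
  obtain ⟨D, r, hD, hr, htail⟩ := exists_variation_le_tail C hlam
  have hβ : 0 < α + 3 / 2 := by linarith
  have hr0 : 0 < r := by linarith
  refine ⟨ENNReal.ofReal A +
    ENNReal.ofReal B * ((D + D) * ENNReal.ofReal (r ^ (α + 3 / 2))), by finiteness,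
    fun f hf hfm y hy hS => ?_⟩
  set S := hardyOp (α + 3 / 2) (fun u => ‖f u‖ₑ) y with hSdef
  set T : ℝ → ℝ≥0∞ := fun x => ∫⁻ t in Ioi (x / r), ‖f t‖ₑ / ENNReal.ofReal t with hT
  have hy0 : 0 < y⁻¹ := inv_pos.2 hy
  have hTS : T y⁻¹ ≤ ENNReal.ofReal (r ^ (α + 3 / 2)) * S :=
    lintegral_tail_le_hardyOp hβ _ hr hy
  have hTtop : T y⁻¹ ≠ ∞ := ne_top_of_le_ne_top (by finiteness) hTS
  have hTanti : Antitone T := fun a b hab =>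
    lintegral_mono_set (Ioi_subset_Ioi (by gcongr))
  have hTlim : Tendsto T atTop (𝓝 0) :=
    (tendsto_lintegral_Ioi_atTop hTtop).comp (tendsto_id.atTop_div_const hr0)
  have hint : ∀ M N : ℝ, 0 < M → M ≤ N → IntervalIntegrable (hankelIntegrand α f y) volume M N :=
    fun M N hM hMN => hf.intervalIntegrable_hankelIntegrand hα hfm hy hM hMN
  have hbound : ∀ M N, y⁻¹ ≤ M → M ≤ N → ‖∫ x in M..N, hankelIntegrand α f y x‖ₑ ≤
      ENNReal.ofReal B * (ENNReal.ofReal y⁻¹ * ((D + D) * T M)) := by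
    intro M N hM hMN
    have hM0 := hy0.trans_le hM
    refine (hf.enorm_integral_hankelIntegrand_le hα hfm hB hy hM hMN).trans ?_
    gcongr
    rw [add_mul]
    refine add_le_add ((htail f hf N N (hM0.trans_le hMN)).2.trans ?_) (htail f hf M N hM0).1
    exact mul_le_mul_right (hTanti hMN) _
  -- the part at infinity
  set I₂ : ℝ → ℂ := fun N => ∫ x in y⁻¹..N, hankelIntegrand α f y x with hI₂
  have hcauchy : CauchySeq I₂ := by
    rw [EMetric.cauchySeq_iff']
    intro ε hε
    have hlim : Tendsto (fun M => ENNReal.ofReal B * (ENNReal.ofReal y⁻¹ * ((D + D) * T M))) atTop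
        (𝓝 0) := by
      have h1 := ENNReal.Tendsto.const_mul hTlim (Or.inr (by finiteness : D + D ≠ ∞))
      have h2 := ENNReal.Tendsto.const_mul h1
        (Or.inr (ENNReal.ofReal_ne_top : ENNReal.ofReal y⁻¹ ≠ ∞))
      have h3 := ENNReal.Tendsto.const_mul h2
        (Or.inr (ENNReal.ofReal_ne_top : ENNReal.ofReal B ≠ ∞))
      simpa only [mul_zero] using h3
    obtain ⟨M, hM, hMy⟩ := ((hlim.eventually_lt_const hε).and (eventually_ge_atTop y⁻¹)).exists
    refine ⟨M, fun N hN => lt_of_le_of_lt ?_ hM⟩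
    rw [edist_eq_enorm_sub, hI₂]
    simp only
    rw [intervalIntegral.integral_interval_sub_left (hint _ _ hy0 (hMy.trans hN))
      (hint _ _ hy0 hMy)]
    exact hbound M N hMy hN
  obtain ⟨L₂, hL₂⟩ := cauchySeq_tendsto_of_complete hcauchy
  have hL₂le : ‖L₂‖ₑ ≤ ENNReal.ofReal B * (ENNReal.ofReal y⁻¹ * ((D + D) * T y⁻¹)) :=
    le_of_tendsto hL₂.enorm ((eventually_ge_atTop y⁻¹).mono fun N hN => hbound _ N le_rfl hN)
  -- the part at the origin
  have hhead := lintegral_head_le_hardyOp hβ hA hbd f hy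
  have hion : IntegrableOn (hankelIntegrand α f y) (uIcc 0 y⁻¹) := by
    rw [uIcc_of_le hy0.le, integrableOn_Icc_iff_integrableOn_Ioc]
    refine ⟨?_, hhead.trans_lt (by finiteness)⟩
    refine (hfm.mono_set Ioc_subset_Ioi_self).mul (ContinuousOn.aestronglyMeasurable
      (Complex.continuous_ofReal.comp_continuousOn
        ((continuousOn_besselKernel_mul hα hy).mono Ioc_subset_Ioi_self)) measurableSet_Ioc)
  set L₁ := ∫ x in (0 : ℝ)..y⁻¹, hankelIntegrand α f y x with hL₁
  have hL₁lim : Tendsto (fun M => ∫ x in M..y⁻¹, hankelIntegrand α f y x) (𝓝[>] 0) (𝓝 L₁) := by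
    have := intervalIntegral.continuousOn_primitive_interval_left hion 0 left_mem_uIcc
    rw [uIcc_of_le hy0.le] at this
    exact this.mono_left (nhdsWithin_le_of_mem (Icc_mem_nhdsGT hy0))
  have hL₁le : ‖L₁‖ₑ ≤ ENNReal.ofReal A * (ENNReal.ofReal y⁻¹ * S) := by
    rw [hL₁, intervalIntegral.integral_of_le hy0.le]
    exact (enorm_integral_le_lintegral_enorm _).trans hhead
  refine ⟨L₁ + L₂, ⟨hint, ?_⟩, ?_⟩
  · refine ((hL₁lim.comp tendsto_fst).add (hL₂.comp tendsto_snd)).congr' ?_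
    have h1 : ∀ᶠ M : ℝ in 𝓝[>] 0, 0 < M ∧ M ≤ y⁻¹ := Ioc_mem_nhdsGT hy0
    filter_upwards [h1.prod_mk (eventually_ge_atTop y⁻¹)] with I hI
    exact intervalIntegral.integral_add_adjacent_intervals (hint _ _ hI.1.1 hI.1.2)
      (hint _ _ hy0 hI.2)
  · calc ‖L₁ + L₂‖ₑ ≤ ‖L₁‖ₑ + ‖L₂‖ₑ := enorm_add_le _ _
      _ ≤ ENNReal.ofReal A * (ENNReal.ofReal y⁻¹ * S) + ENNReal.ofReal B *
          (ENNReal.ofReal y⁻¹ * ((D + D) * (ENNReal.ofReal (r ^ (α + 3 / 2)) * S))) := by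
        refine add_le_add hL₁le (hL₂le.trans ?_)
        gcongr
      _ = _ := by ring

theorem HasHankelIntegral.hankel_eq {y : ℝ} {L : ℂ} (h : HasHankelIntegral α f y L) :
    hankel α f y = L :=
  h.2.limUnder_eq

/-- `H_α f` is a pointwise limit of the integrals over `[1/n, n]`, which are measurable in the
parameter `y`. -/
theorem aestronglyMeasurable_hankel (hα : -1 / 2 ≤ α)
    (hfm : AEStronglyMeasurable f (volume.restrict (Ioi 0)))
    (h : ∀ y, 0 < y → HasHankelIntegral α f y (hankel α f y)) :
    AEStronglyMeasurable (hankel α f) (volume.restrict (Ioi 0)) := by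
  have hM : Tendsto (fun n : ℕ => (1 / ((n : ℝ) + 1), (n : ℝ) + 1)) atTop
      (𝓝[>] (0 : ℝ) ×ˢ atTop) := by
    refine Tendsto.prodMk (tendsto_nhdsWithin_iff.2 ⟨tendsto_one_div_add_atTop_nhds_zero_nat,
      Eventually.of_forall fun n => ?_⟩)
      (tendsto_atTop_add_const_right _ _ tendsto_natCast_atTop_atTop)
    simp only [mem_Ioi]
    positivity
  refine aestronglyMeasurable_of_tendsto_ae (u := atTop)
    (f := fun (n : ℕ) y => ∫ x in (1 / ((n : ℝ) + 1))..((n : ℝ) + 1), hankelIntegrand α f y x)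
    (fun n => ?_) ?_
  · have hn : (0 : ℝ) < 1 / (n + 1) := by positivity
    have hn1 : 1 / ((n : ℝ) + 1) ≤ n + 1 := by
      have : (0 : ℝ) ≤ n := n.cast_nonneg
      rw [div_le_iff₀ (by positivity)]
      nlinarith
    simp_rw [intervalIntegral.integral_of_le hn1]
    set s := Ioc (1 / ((n : ℝ) + 1)) (n + 1)
    have hs : s ⊆ Ioi 0 := fun x hx => hn.trans hx.1
    have hk : AEStronglyMeasurable (fun z : ℝ × ℝ => (besselKernel α (z.2 * z.1) : ℂ))
        ((volume.restrict (Ioi 0)).prod (volume.restrict s)) := by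
      rw [Measure.prod_restrict]
      refine ContinuousOn.aestronglyMeasurable ?_ (measurableSet_Ioi.prod measurableSet_Ioc)
      refine Complex.continuous_ofReal.comp_continuousOn
        ((continuousOn_besselKernel hα).comp (by fun_prop) fun z hz => ?_)
      exact mul_pos (mem_Ioi.1 (hs hz.2)) (mem_Ioi.1 hz.1)
    exact AEStronglyMeasurable.integral_prod_right'
      (f := fun z : ℝ × ℝ => hankelIntegrand α f z.1 z.2)
      ((hfm.mono_set hs).comp_snd.mul hk)
  · filter_upwards [ae_restrict_mem measurableSet_Ioi] with y hy
    exact (h y hy).2.comp hM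

end

theorem mainTheorem6 (α : ℝ) (hα : -1 / 2 ≤ α) (q : ℝ≥0∞) (hq : 1 ≤ q)
    (p : ℝ) (hp : 1 / (α + 3 / 2) < p) (C lam : ℝ) (hC : 0 < C) (hlam : 1 < lam) :
    ∃ K : ℝ, 0 < K ∧ ∀ f : ℝ → ℂ, IsGMWith C lam f → MemT (1 / p) q f →
      (∀ y : ℝ, 0 < y → HasHankelIntegral α f y (hankel α f y)) ∧
      MemT (1 - 1 / p) q (hankel α f) ∧
      tNorm (1 - 1 / p) q (hankel α f) ≤ ENNReal.ofReal K * tNorm (1 / p) q f := by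
  have hβ : 0 < α + 3 / 2 := by linarith
  have hp0 : 0 < p := (by positivity : 0 < 1 / (α + 3 / 2)).trans hp
  have hs : 0 < 1 / p := by positivity
  have hsβ : 1 / p < α + 3 / 2 := (one_div_lt hβ hp0).1 hp
  obtain ⟨A, hA, hmain⟩ := exists_hankel_le_hardyOp hα C (by linarith : 0 < lam)
  set K₀ := A * ENNReal.ofReal (hardyConst (α + 3 / 2) (1 / p)) with hK₀
  have hK₀t : K₀ ≠ ∞ := ENNReal.mul_ne_top hA ENNReal.ofReal_ne_top
  refine ⟨K₀.toReal + 1, by positivity, fun f hf hfT => ?_⟩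
  have hH : ∀ y, 0 < y → HasHankelIntegral α f y (hankel α f y) ∧ ‖hankel α f y‖ₑ ≤
      A * (ENNReal.ofReal y⁻¹ * hardyOp (α + 3 / 2) (fun u => ‖f u‖ₑ) y) := by
    intro y hy
    obtain ⟨L, hL, hle⟩ := hmain f hf hfT.1 y hy (hardyOp_ne_top hs hsβ hq hfT hy)
    rw [hL.hankel_eq]
    exact ⟨hL, hle⟩
  have hnorm : tNorm (1 - 1 / p) q (hankel α f) ≤
      ENNReal.ofReal (K₀.toReal + 1) * tNorm (1 / p) q f := by
    refine (tNorm_le_of_le_hardyOp hs hsβ hq hfT.1 hA fun y hy => (hH y hy).2).trans ?_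
    gcongr
    exact (ENNReal.le_ofReal_iff_toReal_le hK₀t (by positivity)).2 (by linarith)
  exact ⟨fun y hy => (hH y hy).1,
    ⟨aestronglyMeasurable_hankel hα hfT.1 fun y hy => (hH y hy).1,
      hnorm.trans_lt (ENNReal.mul_lt_top ENNReal.ofReal_lt_top hfT.2)⟩, hnorm⟩
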